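/- All manifolds are smooth, real, finite-dimensional, Hausdorff and second-countable, and vector bundles are smooth, real and of finite rank. For a commutative ring $R$, a para-associative $R$-algebra is an $R$-module $\mathcal A$ with a ternary product $[-,-,-]:\mathcal A\times\mathcal A\times\mathcal A\to\mathcal A$ that is $R$-linear in each entry and satisfies $$[[x_1,x_2,x_3],x_4,x_5]=[x_1,[x_4,x_3,x_2],x_5]=[x_1,x_2,[x_3,x_4,x_5]].$$ An isomorphism of para-associative algebras is a linear isomorphism $\phi$ with $\phi[x,y,z]=[\phi(x),\phi(y),\phi(z)]$. A para-associative algebroid over a manifold $M$ is a vector bundle $\pi:E\to M$ together with a para-associative $C^\infty(M)$-algebra structure on its module $\mathrm{Sec}(E)$ of smooth sections. Each fibre $E_m$ is then a real para-associative algebra with the (well-defined) product $[\alpha,\beta,\gamma]:=[u,v,w](m)$, where $u,v,w\in\mathrm{Sec}(E)$ are any sections with $u(m)=\alpha$, $v(m)=\beta$, $w(m)=\gamma$. A linear connection $\nabla:\mathrm{Vect}(M)\times\mathrm{Sec}(E)\to\mathrm{Sec}(E)$ is a map that is $C^\infty(M)$-linear in the vector field, additive in the section, and satisfies $\nabla_X(fu)=f\nabla_Xu+X(f)u$.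 It is a differential connection if $$\nabla_X[u,v,w]=[\nabla_Xu,v,w]+[u,\nabla_Xv,w]+[u,v,\nabla_Xw]$$ for all vector fields $X$ and all $u,v,w\in\mathrm{Sec}(E)$. **Theorem.** Let $E$ be a para-associative algebroid over a connected manifold $M$. If $E$ admits a differential connection, then $E$, with its fibre algebras, is a para-associative algebra bundle: each point of $M$ has an open neighbourhood $U$ for which there exist a real para-associative algebra $\mathcal A$ and a diffeomorphism $\psi:\pi^{-1}(U)\to U\times\mathcal A$ that preserves the fibres and restricts to an isomorphism of para-associative algebras $E_n\to\mathcal A$ for every $n\in U$. Moreover, the fibre algebras $E_m$ and $E_{m'}$ are isomorphic for all $m,m'\in M$. -/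

import Mathlib

open Bundle
open scoped Manifold ContDiff

/-! ### Para-associative algebras over a commutative ring -/

/-- A (ternary) para-associative `R`-algebra structure on an `R`-module `A`: a ternary product,
`R`-linear in each entry, satisfying
`[[x₁,x₂,x₃],x₄,x₅] = [x₁,[x₄,x₃,x₂],x₅] = [x₁,x₂,[x₃,x₄,x₅]]`. -/
structure ParaAssociativeAlgebra (R : Type*) [CommRing R] (A : Type*) [AddCommGroup A]
    [Module R A] where
  /-- The ternary product `[x, y, z]`. -/
  prod : A → A → A → A
  add_left : ∀ x x' y z, prod (x + x') y z = prod x y z + prod x' y z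
  add_mid : ∀ x y y' z, prod x (y + y') z = prod x y z + prod x y' z
  add_right : ∀ x y z z', prod x y (z + z') = prod x y z + prod x y z'
  smul_left : ∀ (r : R) x y z, prod (r • x) y z = r • prod x y z
  smul_mid : ∀ (r : R) x y z, prod x (r • y) z = r • prod x y z
  smul_right : ∀ (r : R) x y z, prod x y (r • z) = r • prod x y z
  para_left_mid : ∀ x₁ x₂ x₃ x₄ x₅,
    prod (prod x₁ x₂ x₃) x₄ x₅ = prod x₁ (prod x₄ x₃ x₂) x₅
  para_mid_right : ∀ x₁ x₂ x₃ x₄ x₅,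
    prod x₁ (prod x₄ x₃ x₂) x₅ = prod x₁ x₂ (prod x₃ x₄ x₅)

/-- A linear isomorphism `φ` is an isomorphism of para-associative algebras if
`φ [x, y, z] = [φ x, φ y, φ z]`. -/
def IsParaAssociativeIso {R : Type*} [CommRing R] {A B : Type*} [AddCommGroup A] [Module R A]
    [AddCommGroup B] [Module R B] (𝒜 : ParaAssociativeAlgebra R A)
    (ℬ : ParaAssociativeAlgebra R B) (φ : A ≃ₗ[R] B) : Prop :=
  ∀ x y z, φ (𝒜.prod x y z) = ℬ.prod (φ x) (φ y) (φ z)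

/-! ### The `C^∞(M)`-module of smooth sections of a vector bundle -/

section Sections

variable {n : ℕ} {M : Type*} [TopologicalSpace M] [ChartedSpace (EuclideanSpace ℝ (Fin n)) M]
  {F : Type*} [NormedAddCommGroup F] [NormedSpace ℝ F]
  {V : M → Type*} [TopologicalSpace (TotalSpace F V)] [∀ m, AddCommGroup (V m)]
  [∀ m, Module ℝ (V m)] [∀ m, TopologicalSpace (V m)] [FiberBundle F V] [VectorBundle ℝ F V]

/-- Pointwise multiplication of a smooth section by a smooth function. -/
noncomputable instance ContMDiffSection.instSMulSmoothFunction :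
    SMul C^∞⟮𝓡 n, M; 𝓘(ℝ), ℝ⟯ Cₛ^∞⟮𝓡 n; F, V⟯ where
  smul f u := ⟨fun m => f m • u m, f.contMDiff.smul_section u.contMDiff⟩

theorem ContMDiffSection.smoothFunction_smul_apply (f : C^∞⟮𝓡 n, M; 𝓘(ℝ), ℝ⟯)
    (u : Cₛ^∞⟮𝓡 n; F, V⟯) (m : M) : (f • u) m = f m • u m := rfl

/-- The smooth sections form a module over the ring of smooth functions. -/
noncomputable instance ContMDiffSection.instModuleSmoothFunction :
    Module C^∞⟮𝓡 n, M; 𝓘(ℝ), ℝ⟯ Cₛ^∞⟮𝓡 n; F, V⟯ where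
  one_smul u := by ext m; exact one_smul ℝ (u m)
  mul_smul f g u := by ext m; exact mul_smul (f m) (g m) (u m)
  smul_zero f := by ext m; exact smul_zero (f m)
  smul_add f u v := by ext m; exact smul_add (f m) (u m) (v m)
  add_smul f g u := by ext m; exact add_smul (f m) (g m) (u m)
  zero_smul u := by ext m; exact zero_smul ℝ (u m)

end Sections

/-- A para-associative algebroid structure on the smooth vector bundle `V → M`: a para-associative
`C^∞(M)`-algebra structure on its space of smooth sections. -/
abbrev ParaAssociativeAlgebroid (n : ℕ) {M : Type*} [TopologicalSpace M]
    [ChartedSpace (EuclideanSpace ℝ (Fin n)) M]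
    (F : Type*) [NormedAddCommGroup F] [NormedSpace ℝ F]
    (V : M → Type*) [TopologicalSpace (TotalSpace F V)] [∀ m, AddCommGroup (V m)]
    [∀ m, Module ℝ (V m)] [∀ m, TopologicalSpace (V m)] [FiberBundle F V] [VectorBundle ℝ F V] :=
  ParaAssociativeAlgebra C^∞⟮𝓡 n, M; 𝓘(ℝ), ℝ⟯ Cₛ^∞⟮𝓡 n; F, V⟯

/-! ### Linear connections -/

/-- A linear (Koszul) connection `∇ : Vect(M) × Sec(V) → Sec(V)`: it is `C^∞(M)`-linear in the
vector field, additive in the section, and `∇_X (f u) = f ∇_X u + X(f) u`. -/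
structure LinearConnection (n : ℕ) {M : Type*} [TopologicalSpace M]
    [ChartedSpace (EuclideanSpace ℝ (Fin n)) M] [IsManifold (𝓡 n) ∞ M]
    (F : Type*) [NormedAddCommGroup F] [NormedSpace ℝ F]
    (V : M → Type*) [TopologicalSpace (TotalSpace F V)] [∀ m, AddCommGroup (V m)]
    [∀ m, Module ℝ (V m)] [∀ m, TopologicalSpace (V m)] [FiberBundle F V]
    [VectorBundle ℝ F V] where
  /-- The covariant derivative `∇_X u`. -/
  nabla : Cₛ^∞⟮𝓡 n; EuclideanSpace ℝ (Fin n), (TangentSpace (𝓡 n) : M → Type _)⟯ →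
    Cₛ^∞⟮𝓡 n; F, V⟯ → Cₛ^∞⟮𝓡 n; F, V⟯
  add_field : ∀ X Y u, nabla (X + Y) u = nabla X u + nabla Y u
  smul_field : ∀ (f : C^∞⟮𝓡 n, M; 𝓘(ℝ), ℝ⟯) X u, nabla (f • X) u = f • nabla X u
  add_section : ∀ X u v, nabla X (u + v) = nabla X u + nabla X v
  leibniz : ∀ X (f : C^∞⟮𝓡 n, M; 𝓘(ℝ), ℝ⟯) u (m : M),
    nabla X (f • u) m = f m • nabla X u m + (mvfderiv (𝓡 n) f m (X m)) • u m

section Algebroid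

variable {n : ℕ} {M : Type*} [TopologicalSpace M] [ChartedSpace (EuclideanSpace ℝ (Fin n)) M]
  [IsManifold (𝓡 n) ∞ M]
  {F : Type*} [NormedAddCommGroup F] [NormedSpace ℝ F]
  {V : M → Type*} [TopologicalSpace (TotalSpace F V)] [∀ m, AddCommGroup (V m)]
  [∀ m, Module ℝ (V m)] [∀ m, TopologicalSpace (V m)] [FiberBundle F V] [VectorBundle ℝ F V]

/-- A connection on a para-associative algebroid is a differential connection if it satisfies
the ternary Leibniz rule `∇_X [u,v,w] = [∇_X u,v,w] + [u,∇_X v,w] + [u,v,∇_X w]`. -/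
def LinearConnection.IsDifferential (D : LinearConnection n F V)
    (A : ParaAssociativeAlgebroid n F V) : Prop :=
  ∀ X u v w, D.nabla X (A.prod u v w) =
    A.prod (D.nabla X u) v w + A.prod u (D.nabla X v) w + A.prod u v (D.nabla X w)

/-! ### The fibre algebras of a para-associative algebroid -/

variable [T2Space M] [ContMDiffVectorBundle ∞ F V (𝓡 n)]

/-- Every vector is the value of a smooth section. -/
theorem exists_section_eq (m : M) (α : V m) : ∃ u : Cₛ^∞⟮𝓡 n; F, V⟯, u m = α := by
  let e := trivializationAt F V m
  have hm : m ∈ e.baseSet := FiberBundle.mem_baseSet_trivializationAt F V m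
  obtain ⟨ψ, hψ, -⟩ := (SmoothBumpFunction.nhds_basis_support (I := 𝓡 n)
    (e.open_baseSet.mem_nhds hm)).mem_iff.1 (e.open_baseSet.mem_nhds hm)
  have hs : ContMDiffOn (𝓡 n) ((𝓡 n).prod 𝓘(ℝ, F)) ∞
      (fun x => TotalSpace.mk' F x (FiberBundle.extend F α x)) e.baseSet := by
    rw [e.contMDiffOn_section_baseSet_iff]
    refine (contMDiffOn_const (c := (e ⟨m, α⟩).2)).congr fun y hy => ?_
    simp only [FiberBundle.extend]
    rw [e.apply_mk_symm hy]
  refine ⟨⟨(ψ : M → ℝ) • FiberBundle.extend F α,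
    ContMDiffOn.smul_section_of_tsupport ψ.contMDiff.contMDiffOn e.open_baseSet hψ hs⟩, ?_⟩
  change ψ m • FiberBundle.extend F α m = α
  simp

variable [FiniteDimensional ℝ F]

/-- A `C^∞(M)`-linear operation on sections maps a section vanishing at `m` to a section
vanishing at `m`. -/
theorem tensorial_apply_eq_zero {Φ : Cₛ^∞⟮𝓡 n; F, V⟯ → Cₛ^∞⟮𝓡 n; F, V⟯}
    (hadd : ∀ u v, Φ (u + v) = Φ u + Φ v)
    (hsmul : ∀ (f : C^∞⟮𝓡 n, M; 𝓘(ℝ), ℝ⟯) u, Φ (f • u) = f • Φ u)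
    {u : Cₛ^∞⟮𝓡 n; F, V⟯} {m : M} (hu : u m = 0) : Φ u m = 0 := by
  have : ContMDiffVectorBundle 1 F V (𝓡 n) := ContMDiffVectorBundle.of_le (by simp) (n := ∞)
  let L : Cₛ^∞⟮𝓡 n; F, V⟯ →ₗ[C^∞⟮𝓡 n, M; 𝓘(ℝ), ℝ⟯] Cₛ^∞⟮𝓡 n; F, V⟯ :=
    { toFun := Φ, map_add' := hadd, map_smul' := hsmul }
  let e := trivializationAt F V m
  have hm : m ∈ e.baseSet := FiberBundle.mem_baseSet_trivializationAt F V m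
  obtain ⟨ψ, hψ, -⟩ := (SmoothBumpFunction.nhds_basis_support (I := 𝓡 n)
    (e.open_baseSet.mem_nhds hm)).mem_iff.1 (e.open_baseSet.mem_nhds hm)
  let b := Module.finBasis ℝ F
  let S (i) : Cₛ^∞⟮𝓡 n; F, V⟯ := ⟨(ψ : M → ℝ) • e.localFrame b i,
    ContMDiffOn.smul_section_of_tsupport ψ.contMDiff.contMDiffOn e.open_baseSet hψ
      (e.contMDiffOn_localFrame_baseSet _ b i)⟩
  let c (i) : C^∞⟮𝓡 n, M; 𝓘(ℝ), ℝ⟯ :=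
    ⟨fun x => ψ x • e.localFrameCoeff (𝓡 n) b i x (u x), by
      refine contMDiff_of_tsupport fun x hx => ?_
      have hx' : x ∈ e.baseSet := hψ (closure_mono (Function.support_smul_subset_left _ _) hx)
      exact ψ.contMDiffAt.smul (contMDiffAt_localFrameCoeff b hx' (u.contMDiff x) i)⟩
  let p : C^∞⟮𝓡 n, M; 𝓘(ℝ), ℝ⟯ := ⟨ψ, ψ.contMDiff⟩
  have key : (p * p) • u = ∑ i, c i • S i := by
    ext x
    have hsum : (∑ i, c i • S i) x = ∑ i, (c i • S i) x := by
      have := congrFun (map_sum (ContMDiffSection.coeAddHom (𝓡 n) F ∞ V)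
        (fun i => c i • S i) Finset.univ) x
      rwa [Finset.sum_apply] at this
    rw [hsum]
    change (ψ x * ψ x) • u x = ∑ i, (ψ x • e.localFrameCoeff (𝓡 n) b i x (u x)) •
      (ψ x • e.localFrame b i x)
    by_cases hx : x ∈ e.baseSet
    · conv_lhs => rw [e.eq_sum_localFrameCoeff_smul (I := 𝓡 n) (b := b) (s := fun x => u x) hx]
      rw [Finset.smul_sum]
      refine Finset.sum_congr rfl fun i _ => ?_
      simp only [smul_smul, smul_eq_mul]
      congr 1
      ring
    · have : ψ x = 0 := image_eq_zero_of_notMem_tsupport fun h => hx (hψ h)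
      simp [this]
  have h2 : (p * p) • L u = ∑ i, c i • L (S i) := by
    rw [← map_smul, key, map_sum]
    simp only [map_smul]
  have h3 := congrArg (fun s : Cₛ^∞⟮𝓡 n; F, V⟯ => s m) h2
  have hsum : (∑ i, c i • L (S i)) m = ∑ i, (c i • L (S i)) m := by
    have := congrFun (map_sum (ContMDiffSection.coeAddHom (𝓡 n) F ∞ V)
      (fun i => c i • L (S i)) Finset.univ) m
    rwa [Finset.sum_apply] at this
  simp only [hsum] at h3
  change (ψ m * ψ m) • Φ u m = ∑ i, (ψ m • e.localFrameCoeff (𝓡 n) b i m (u m)) • L (S i) m at h3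
  simpa [hu] using h3

theorem tensorial_apply_congr {Φ : Cₛ^∞⟮𝓡 n; F, V⟯ → Cₛ^∞⟮𝓡 n; F, V⟯}
    (hadd : ∀ u v, Φ (u + v) = Φ u + Φ v)
    (hsmul : ∀ (f : C^∞⟮𝓡 n, M; 𝓘(ℝ), ℝ⟯) u, Φ (f • u) = f • Φ u)
    {u v : Cₛ^∞⟮𝓡 n; F, V⟯} {m : M} (huv : u m = v m) : Φ u m = Φ v m := by
  have h := tensorial_apply_eq_zero hadd hsmul (u := u - v) (m := m) (by simp [huv])
  have h2 : Φ u = Φ (u - v) + Φ v := by rw [← hadd, sub_add_cancel]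
  rw [h2, ContMDiffSection.coe_add, Pi.add_apply, h, zero_add]

/-- The value `[u, v, w](m)` depends only on `u(m)`, `v(m)`, `w(m)`. -/
theorem ParaAssociativeAlgebroid.prod_apply_congr (A : ParaAssociativeAlgebroid n F V)
    {u u' v v' w w' : Cₛ^∞⟮𝓡 n; F, V⟯} {m : M} (hu : u m = u' m) (hv : v m = v' m)
    (hw : w m = w' m) : A.prod u v w m = A.prod u' v' w' m := by
  rw [tensorial_apply_congr (Φ := fun s => A.prod s v w) (fun _ _ => A.add_left _ _ _ _)
      (fun _ _ => A.smul_left _ _ _ _) hu,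
    tensorial_apply_congr (Φ := fun s => A.prod u' s w) (fun _ _ => A.add_mid _ _ _ _)
      (fun _ _ => A.smul_mid _ _ _ _) hv,
    tensorial_apply_congr (Φ := fun s => A.prod u' v' s) (fun _ _ => A.add_right _ _ _ _)
      (fun _ _ => A.smul_right _ _ _ _) hw]

/-- A smooth section with prescribed value at `m`. -/
noncomputable def sectionThrough (m : M) (α : V m) : Cₛ^∞⟮𝓡 n; F, V⟯ :=
  (exists_section_eq m α).choose

theorem sectionThrough_apply (m : M) (α : V m) :
    (sectionThrough m α : Cₛ^∞⟮𝓡 n; F, V⟯) m = α :=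
  (exists_section_eq m α).choose_spec

/-- The para-associative algebra on the fibre over `m` of a para-associative algebroid:
`[α, β, γ] = [u, v, w](m)` for any smooth sections `u`, `v`, `w` with `u(m) = α`, `v(m) = β`,
`w(m) = γ`. -/
noncomputable def ParaAssociativeAlgebroid.fibre (A : ParaAssociativeAlgebroid n F V) (m : M) :
    ParaAssociativeAlgebra ℝ (V m) where
  prod α β γ := A.prod (sectionThrough m α) (sectionThrough m β) (sectionThrough m γ) m
  add_left α α' β γ := by
    refine Eq.trans (prod_apply_congr A (u' := sectionThrough m α + sectionThrough m α')
      ?_ rfl rfl) ?_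
    · simp [sectionThrough_apply]
    · rw [A.add_left]
      rfl
  add_mid α β β' γ := by
    refine Eq.trans (prod_apply_congr A (v' := sectionThrough m β + sectionThrough m β')
      rfl ?_ rfl) ?_
    · simp [sectionThrough_apply]
    · rw [A.add_mid]
      rfl
  add_right α β γ γ' := by
    refine Eq.trans (prod_apply_congr A (w' := sectionThrough m γ + sectionThrough m γ')
      rfl rfl ?_) ?_
    · simp [sectionThrough_apply]
    · rw [A.add_right]
      rfl
  smul_left r α β γ := by
    refine Eq.trans (prod_apply_congr A (u' := (ContMDiffMap.C r : C^∞⟮𝓡 n, M; 𝓘(ℝ), ℝ⟯) •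
      sectionThrough m α) ?_ rfl rfl) ?_
    · rw [ContMDiffSection.smoothFunction_smul_apply]
      simp only [sectionThrough_apply]
      rfl
    · rw [A.smul_left]
      rfl
  smul_mid r α β γ := by
    refine Eq.trans (prod_apply_congr A (v' := (ContMDiffMap.C r : C^∞⟮𝓡 n, M; 𝓘(ℝ), ℝ⟯) •
      sectionThrough m β) rfl ?_ rfl) ?_
    · rw [ContMDiffSection.smoothFunction_smul_apply]
      simp only [sectionThrough_apply]
      rfl
    · rw [A.smul_mid]
      rfl
  smul_right r α β γ := by
    refine Eq.trans (prod_apply_congr A (w' := (ContMDiffMap.C r : C^∞⟮𝓡 n, M; 𝓘(ℝ), ℝ⟯) •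
      sectionThrough m γ) rfl rfl ?_) ?_
    · rw [ContMDiffSection.smoothFunction_smul_apply]
      simp only [sectionThrough_apply]
      rfl
    · rw [A.smul_right]
      rfl
  para_left_mid x₁ x₂ x₃ x₄ x₅ := by
    refine Eq.trans (prod_apply_congr A (sectionThrough_apply m _) rfl rfl) ?_
    rw [A.para_left_mid]
    exact prod_apply_congr A rfl (sectionThrough_apply m _).symm rfl
  para_mid_right x₁ x₂ x₃ x₄ x₅ := by
    refine Eq.trans (prod_apply_congr A rfl (sectionThrough_apply m _) rfl) ?_
    rw [A.para_mid_right]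
    exact prod_apply_congr A rfl rfl (sectionThrough_apply m _).symm

/-- The defining property of the fibre algebras: `[u, v, w](m) = [u(m), v(m), w(m)]`. -/
theorem ParaAssociativeAlgebroid.fibre_prod_apply (A : ParaAssociativeAlgebroid n F V) (m : M)
    (u v w : Cₛ^∞⟮𝓡 n; F, V⟯) : (A.fibre m).prod (u m) (v m) (w m) = A.prod u v w m :=
  prod_apply_congr A (sectionThrough_apply m _) (sectionThrough_apply m _)
    (sectionThrough_apply m _)

end Algebroid

/-! ### Para-associative algebra bundles -/

/-- A smooth vector bundle `V → M` with para-associative algebras `μ m` on its fibres is a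
para-associative algebra bundle if around each point there are an open set `U` (the base set of
`e`), a para-associative algebra `𝒜`, and a fibre-preserving diffeomorphism
`e : π⁻¹(U) → U × 𝒜` restricting to an algebra isomorphism `V x ≃ 𝒜` for every `x ∈ U`.
Since `𝒜` is then linearly isomorphic to the model fibre `F`, its underlying vector space is
taken to be `F`. -/
def IsParaAssociativeAlgebraBundle (n : ℕ) {M : Type*} [TopologicalSpace M]
    [ChartedSpace (EuclideanSpace ℝ (Fin n)) M]
    (F : Type*) [NormedAddCommGroup F] [NormedSpace ℝ F]
    {V : M → Type*} [TopologicalSpace (TotalSpace F V)] [∀ m, AddCommGroup (V m)]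
    [∀ m, Module ℝ (V m)] [∀ m, TopologicalSpace (V m)] [FiberBundle F V]
    (μ : ∀ m, ParaAssociativeAlgebra ℝ (V m)) : Prop :=
  ∀ m : M, ∃ (𝒜 : ParaAssociativeAlgebra ℝ F) (e : Trivialization F (π F V)),
    m ∈ e.baseSet ∧
    ContMDiffOn ((𝓡 n).prod 𝓘(ℝ, F)) ((𝓡 n).prod 𝓘(ℝ, F)) ∞ e e.source ∧
    ContMDiffOn ((𝓡 n).prod 𝓘(ℝ, F)) ((𝓡 n).prod 𝓘(ℝ, F)) ∞
      e.toOpenPartialHomeomorph.symm e.target ∧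
    ∀ x ∈ e.baseSet, ∃ φ : V x ≃ₗ[ℝ] F, IsParaAssociativeIso (μ x) 𝒜 φ ∧
      ∀ α : V x, e ⟨x, α⟩ = (x, φ α)

/-! In a local trivialization the fibre products form a smooth family $\mu$ of trilinear products on
the model fibre $F$, and $\nabla_X = \Gamma + d_X$. Applied to constant sections, the ternary
Leibniz rule says that each derivative of $\mu$ is the infinitesimal action of an endomorphism,
namely $-\Gamma$. So $\mu$ moves tangentially to the orbits of $GL(F)$, and the claim is that it
stays in one orbit near $m$, with a conjugating automorphism depending smoothly on the point.

Instead of parallel transport along rays, the argument uses a slice for the group action at $\mu_0 =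
\mu(x_0)$ (`exists_slice`): by the inverse function theorem every nearby product is $g \cdot \nu$,
with $g$ and $\nu$ depending smoothly on it and $\nu - \mu_0$ in the kernel of a projection $P$ onto
the tangent space of the orbit. Along the family, $\nu$ again moves by an infinitesimal action,
while $P\nu$ is constant. Together these give a differential inequality $\|dc(v)\| \le K\|v\|\|c\|$
for $c = \nu - \mu_0$, and Grönwall (`eqOn_ball_zero_of_norm_fderiv_le`) forces $c = 0$. Thus $\mu =
g \cdot \mu_0$ (`exists_gauge`). Only local bounds on $\Gamma$ enter; smoothness of $g$ comes from
that of $\mu$ and of the slice.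

Correcting the trivialization by $g^{-1}$ gives an algebra bundle chart. Isomorphism classes of
fibres are then open, so connectedness leaves only one. -/

open Filter Topology

set_option maxSynthPendingDepth 3

/-! ### Gauge transformations of trilinear products -/

section Gauge

variable {E F : Type*} [NormedAddCommGroup E] [NormedSpace ℝ E]
  [NormedAddCommGroup F] [NormedSpace ℝ F]

/-- Continuous trilinear products on `F`, in curried form. -/
abbrev TrilinearProduct (F : Type*) [NormedAddCommGroup F] [NormedSpace ℝ F] :=
  F →L[ℝ] F →L[ℝ] F →L[ℝ] F

namespace TrilinearProduct

/-- The infinitesimal action of an endomorphism `h` on trilinear products. -/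
noncomputable def infAct (h : F →L[ℝ] F) (μ : TrilinearProduct F) : TrilinearProduct F :=
  (ContinuousLinearMap.compL ℝ F (F →L[ℝ] F) (F →L[ℝ] F)
      (ContinuousLinearMap.compL ℝ F F F h)) ∘L μ - μ ∘L h
    - ((ContinuousLinearMap.compL ℝ F F (F →L[ℝ] F)).flip h) ∘L μ
    - (ContinuousLinearMap.compL ℝ F (F →L[ℝ] F) (F →L[ℝ] F)
      ((ContinuousLinearMap.compL ℝ F F F).flip h)) ∘L μ

@[simp]
theorem infAct_apply (h : F →L[ℝ] F) (μ : TrilinearProduct F) (a b c : F) :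
    infAct h μ a b c = h (μ a b c) - μ (h a) b c - μ a (h b) c - μ a b (h c) := by
  simp [infAct]

theorem infAct_add_right (h : F →L[ℝ] F) (μ ν : TrilinearProduct F) :
    infAct h (μ + ν) = infAct h μ + infAct h ν := by
  ext a b c
  simp only [infAct_apply, add_apply, map_add]
  abel

theorem norm_infAct_le (h : F →L[ℝ] F) (μ : TrilinearProduct F) :
    ‖infAct h μ‖ ≤ 4 * ‖h‖ * ‖μ‖ := by
  have key (a b c : F) : ‖μ a b c‖ ≤ ‖μ‖ * ‖a‖ * ‖b‖ * ‖c‖ :=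
    (ContinuousLinearMap.le_opNorm₂ (μ a) b c).trans (by gcongr; exact μ.le_opNorm a)
  refine ContinuousLinearMap.opNorm_le_bound _ (by positivity) fun a => ?_
  refine ContinuousLinearMap.opNorm_le_bound _ (by positivity) fun b => ?_
  refine ContinuousLinearMap.opNorm_le_bound _ (by positivity) fun c => ?_
  rw [infAct_apply]
  have h1 : ‖h (μ a b c)‖ ≤ ‖h‖ * (‖μ‖ * ‖a‖ * ‖b‖ * ‖c‖) :=
    (h.le_opNorm _).trans (by gcongr; exact key a b c)
  have h2 : ‖μ (h a) b c‖ ≤ ‖μ‖ * (‖h‖ * ‖a‖) * ‖b‖ * ‖c‖ :=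
    (key _ _ _).trans (by gcongr; exact h.le_opNorm a)
  have h3 : ‖μ a (h b) c‖ ≤ ‖μ‖ * ‖a‖ * (‖h‖ * ‖b‖) * ‖c‖ :=
    (key _ _ _).trans (by gcongr; exact h.le_opNorm b)
  have h4 : ‖μ a b (h c)‖ ≤ ‖μ‖ * ‖a‖ * ‖b‖ * (‖h‖ * ‖c‖) :=
    (key _ _ _).trans (by gcongr; exact h.le_opNorm c)
  refine (norm_sub_le_of_le (norm_sub_le_of_le (norm_sub_le_of_le h1 h2) h3) h4).trans
    (le_of_eq (by ring))

/-- The infinitesimal action on a fixed product, as a linear map of the endomorphism. -/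
noncomputable def infActₗ (μ : TrilinearProduct F) : (F →L[ℝ] F) →ₗ[ℝ] TrilinearProduct F where
  toFun h := infAct h μ
  map_add' h k := by
    ext a b c
    simp only [infAct_apply, add_apply, map_add]
    abel
  map_smul' r h := by
    ext a b c
    simp only [infAct_apply, smul_apply, map_smul, RingHom.id_apply, smul_sub]

theorem infActₗ_apply (μ : TrilinearProduct F) (h : F →L[ℝ] F) : infActₗ μ h = infAct h μ := rfl

/-- The product `(x, y, z) ↦ a (μ (b x) (b y) (b z))`. -/
noncomputable def conj (a b : F →L[ℝ] F) (μ : TrilinearProduct F) : TrilinearProduct F :=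
  let K : (F →L[ℝ] F) →L[ℝ] (F →L[ℝ] F) :=
    (ContinuousLinearMap.compL ℝ F F F a) ∘L ((ContinuousLinearMap.compL ℝ F F F).flip b)
  ((ContinuousLinearMap.compL ℝ F (F →L[ℝ] F) (F →L[ℝ] F) K) ∘L
    ((ContinuousLinearMap.compL ℝ F F (F →L[ℝ] F)).flip b)) ∘L μ ∘L b

@[simp]
theorem conj_apply (a b : F →L[ℝ] F) (μ : TrilinearProduct F) (x y z : F) :
    conj a b μ x y z = a (μ (b x) (b y) (b z)) := by
  simp [conj]

theorem contDiffOn_of_apply [FiniteDimensional ℝ F] {n : ℕ∞ω}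
    {f : E → TrilinearProduct F} {s : Set E}
    (hf : ∀ x y z, ContDiffOn ℝ n (fun e => f e x y z) s) : ContDiffOn ℝ n f s :=
  contDiffOn_clm_apply.2 fun x => contDiffOn_clm_apply.2 fun y => contDiffOn_clm_apply.2 (hf x y)

/-- The product rule applied to both sides of the intertwining relation. Keeping `g` on both sides
avoids differentiating an inverse; the formula yields the derivative of the slice chart as well as
the equation satisfied by the slice component of a family. -/
theorem fderiv_intertwining {μ ν : E → TrilinearProduct F} {g : E → (F →L[ℝ] F)} {x : E}
    (hμ : DifferentiableAt ℝ μ x) (hν : DifferentiableAt ℝ ν x) (hg : DifferentiableAt ℝ g x)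
    (h : ∀ᶠ y in 𝓝 x, ∀ a b c, g y (ν y a b c) = μ y (g y a) (g y b) (g y c)) (v : E) (a b c : F) :
    fderiv ℝ g x v (ν x a b c) + g x (fderiv ℝ ν x v a b c) =
      fderiv ℝ μ x v (g x a) (g x b) (g x c) + μ x (fderiv ℝ g x v a) (g x b) (g x c) +
      μ x (g x a) (fderiv ℝ g x v b) (g x c) + μ x (g x a) (g x b) (fderiv ℝ g x v c) := by
  have hc (d : F) := hasFDerivAt_const (𝕜 := ℝ) d x
  have hl := hg.hasFDerivAt.clm_apply
    (((hν.hasFDerivAt.clm_apply (hc a)).clm_apply (hc b)).clm_apply (hc c))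
  have hr := ((hμ.hasFDerivAt.clm_apply (hg.hasFDerivAt.clm_apply (hc a))).clm_apply
    (hg.hasFDerivAt.clm_apply (hc b))).clm_apply (hg.hasFDerivAt.clm_apply (hc c))
  have he : (fun y => g y (ν y a b c)) =ᶠ[𝓝 x] fun y => μ y (g y a) (g y b) (g y c) :=
    h.mono fun y hy => hy a b c
  have := congrArg (fun L => L v) (hl.unique (hr.congr_of_eventuallyEq he))
  simp at this
  rw [add_comm, this]
  abel

end TrilinearProduct

/-- A right inverse of `S` onto its range, extended linearly to all of `W`. Its use is that `S ∘ Q`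
is then a projection onto the range of `S`. -/
theorem LinearMap.exists_generalized_inverse {K V W : Type*} [Field K] [AddCommGroup V] [Module K V]
    [AddCommGroup W] [Module K W] (S : V →ₗ[K] W) : ∃ Q : W →ₗ[K] V, ∀ v, S (Q (S v)) = S v := by
  obtain ⟨r, hr⟩ := S.rangeRestrict.exists_rightInverse_of_surjective S.range_rangeRestrict
  obtain ⟨Q, hQ⟩ := LinearMap.exists_extend r
  refine ⟨Q, fun v => ?_⟩
  have h1 : Q (S v) = r (S.rangeRestrict v) := LinearMap.congr_fun hQ (S.rangeRestrict v)
  have h2 := congrArg Subtype.val (LinearMap.congr_fun hr (S.rangeRestrict v))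
  rw [h1]
  exact h2

/-- Grönwall's inequality along the segment from `x₀` to `x`, on which the derivative is bounded by
`K * ‖x - x₀‖` times the function. -/
theorem eqOn_ball_zero_of_norm_fderiv_le {f : E → F} {x₀ : E} {r K : ℝ}
    (hf : ∀ x ∈ Metric.ball x₀ r, DifferentiableAt ℝ f x) (h0 : f x₀ = 0)
    (hK : ∀ x ∈ Metric.ball x₀ r, ∀ v, ‖fderiv ℝ f x v‖ ≤ K * ‖v‖ * ‖f x‖) :
    ∀ x ∈ Metric.ball x₀ r, f x = 0 := by
  intro x hx
  have hmem (t : ℝ) (ht : t ∈ Set.Icc (0 : ℝ) 1) : x₀ + t • (x - x₀) ∈ Metric.ball x₀ r := by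
    rw [Metric.mem_ball, dist_eq_norm] at hx ⊢
    rw [add_sub_cancel_left, norm_smul, Real.norm_of_nonneg ht.1]
    exact (mul_le_of_le_one_left (norm_nonneg _) ht.2).trans_lt hx
  have hd (t : ℝ) (ht : t ∈ Set.Icc (0 : ℝ) 1) : HasDerivAt (fun t : ℝ => f (x₀ + t • (x - x₀)))
      (fderiv ℝ f (x₀ + t • (x - x₀)) (x - x₀)) t := by
    refine (hf _ (hmem t ht)).hasFDerivAt.comp_hasDerivAt t ?_
    simpa using ((hasDerivAt_id t).smul_const (x - x₀)).const_add x₀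
  have := eq_zero_of_abs_deriv_le_mul_abs_self_of_eq_zero_right (K := K * ‖x - x₀‖)
    (fun t ht => (hd t ht).continuousAt.continuousWithinAt)
    (fun t ht => (hd t (Set.Ico_subset_Icc_self ht)).hasDerivWithinAt)
    (by simpa using h0) (fun t ht => hK _ (hmem t (Set.Ico_subset_Icc_self ht)) _) 1 (by simp)
  simpa using this

/-! ### Slices for the general linear group and constancy up to gauge -/

namespace TrilinearProduct

variable [FiniteDimensional ℝ F]

/-- A local slice at `μ₀` for the action of the general linear group on trilinear products. -/
theorem exists_slice (μ₀ : TrilinearProduct F) :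
    ∃ (P : TrilinearProduct F →L[ℝ] TrilinearProduct F) (G : TrilinearProduct F → (F →L[ℝ] F))
      (N : TrilinearProduct F → TrilinearProduct F),
      ContDiffAt ℝ ω G μ₀ ∧ ContDiffAt ℝ ω N μ₀ ∧ G μ₀ = 1 ∧ N μ₀ = μ₀ ∧
      (∀ h, P (infAct h μ₀) = infAct h μ₀) ∧ (∀ μ, P (N μ) = P μ₀) ∧
      ∀ᶠ μ in 𝓝 μ₀, ∀ a b c, G μ (N μ a b c) = μ (G μ a) (G μ b) (G μ c) := by
  have : CompleteSpace F := FiniteDimensional.complete ℝ F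
  have : FiniteDimensional ℝ (TrilinearProduct F) := inferInstance
  have : CompleteSpace (TrilinearProduct F) := FiniteDimensional.complete ℝ _
  -- The range of `infActₗ μ₀` is the tangent space of the orbit at `μ₀`; `P` projects onto it, and
  -- `Q` picks an endomorphism realizing the projected direction.
  obtain ⟨Q₀, hQ₀⟩ := (infActₗ μ₀).exists_generalized_inverse
  let Q : TrilinearProduct F →L[ℝ] (F →L[ℝ] F) := Q₀.toContinuousLinearMap
  let P : TrilinearProduct F →L[ℝ] TrilinearProduct F := (infActₗ μ₀ ∘ₗ Q₀).toContinuousLinearMap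
  have hP (t) : P t = infAct (Q t) μ₀ := rfl
  have hPS (h) : P (infAct h μ₀) = infAct h μ₀ := hQ₀ h
  have hPP (t) : P (P t) = P t := by rw [hP t, hPS]
  -- A parameter `t` is split in two: `P t` is produced by the group element `1 + Q t`, and `t - P
  -- t` by a displacement inside the slice. The action of `g t` on `ν t` will have derivative `P t +
  -- (t - P t) = t` at `0`.
  let g : TrilinearProduct F → (F →L[ℝ] F) := fun t => 1 + Q t
  let ν : TrilinearProduct F → TrilinearProduct F := fun t => μ₀ + (t - P t)
  have hg : ContDiff ℝ ω g := contDiff_const.add Q.contDiff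
  have hν : ContDiff ℝ ω ν := contDiff_const.add (contDiff_id.sub P.contDiff)
  have hg0 : g 0 = 1 := by simp [g]
  have hν0 : ν 0 = μ₀ := by simp [ν]
  have hinv : ContDiffAt ℝ ω (fun t => Ring.inverse (g t)) 0 := by
    refine ContDiffAt.comp (g := Ring.inverse) (0 : TrilinearProduct F) ?_ hg.contDiffAt
    rw [hg0]
    exact contDiffAt_ringInverse ℝ (1 : (F →L[ℝ] F)ˣ)
  -- Analyticity is used because, unlike `ContDiffAt` of order `∞`, it passes from a point to a
  -- neighbourhood.
  obtain ⟨s, hs, hinvs⟩ : ∃ s ∈ 𝓝 (0 : TrilinearProduct F),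
      ContDiffOn ℝ ω (fun t => Ring.inverse (g t)) s := by
    obtain ⟨s, hs, h⟩ := (hinv.eventually (by simp)).exists_mem
    exact ⟨s, hs, fun x hx => (h x hx).contDiffWithinAt⟩
  let Φ : TrilinearProduct F → TrilinearProduct F := fun t => conj (g t) (Ring.inverse (g t)) (ν t)
  have hΦ : ContDiffAt ℝ ω Φ 0 := by
    refine ContDiffOn.contDiffAt (contDiffOn_of_apply fun x y z => ?_) hs
    simp only [Φ, conj_apply]
    exact hg.contDiffOn.clm_apply (((hν.contDiffOn.clm_apply
      (hinvs.clm_apply contDiffOn_const)).clm_apply (hinvs.clm_apply contDiffOn_const)).clm_apply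
      (hinvs.clm_apply contDiffOn_const))
  have hΦg : ∀ᶠ t in 𝓝 (0 : TrilinearProduct F), ∀ a b c,
      g t (ν t a b c) = Φ t (g t a) (g t b) (g t c) := by
    have hu : ∀ᶠ t in 𝓝 (0 : TrilinearProduct F), IsUnit (g t) := by
      refine hg.continuous.continuousAt.eventually (p := fun a => IsUnit a) ?_
      exact Units.isOpen.mem_nhds (by rw [hg0]; exact isUnit_one)
    filter_upwards [hu] with t ht a b c
    have (x : F) : Ring.inverse (g t) (g t x) = x :=
      DFunLike.congr_fun (Ring.inverse_mul_cancel _ ht) x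
    simp [Φ, this]
  have hΦ0 : Φ 0 = μ₀ := by
    ext a b c
    simpa [hg0, hν0] using (hΦg.self_of_nhds a b c).symm
  have hder : HasFDerivAt Φ
      ((ContinuousLinearEquiv.refl ℝ (TrilinearProduct F) : _ →L[ℝ] TrilinearProduct F)) 0 := by
    have hd := hΦ.differentiableAt (by simp)
    suffices h : ContinuousLinearMap.id ℝ _ = fderiv ℝ Φ 0 by
      have h' := hd.hasFDerivAt
      rwa [← h] at h'
    refine ContinuousLinearMap.ext fun t => ?_
    ext a b c
    have hQ' : HasFDerivAt g Q 0 := Q.hasFDerivAt.const_add 1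
    have hν' : HasFDerivAt ν (ContinuousLinearMap.id ℝ _ - P) 0 :=
      ((hasFDerivAt_id _).sub P.hasFDerivAt).const_add μ₀
    have := fderiv_intertwining hd hν'.differentiableAt hQ'.differentiableAt hΦg t a b c
    rw [hQ'.fderiv, hν'.fderiv, hg0, hν0, hΦ0] at this
    simp only [hP, sub_apply, ContinuousLinearMap.id_apply, infAct_apply,
      one_apply_eq_self] at this ⊢
    rw [← sub_eq_zero] at this ⊢
    rw [← this]
    abel
  -- The inverse function theorem turns the parametrization `Φ` into a decomposition of every
  -- product near `μ₀`.
  let Ψ := hΦ.localInverse hder (by simp)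
  have hΨ0 : Ψ μ₀ = 0 := by
    have := hΦ.localInverse_apply_image hder (by simp)
    rwa [hΦ0] at this
  have hΨ : ContDiffAt ℝ ω Ψ μ₀ := by
    have := hΦ.to_localInverse hder (by simp)
    rwa [hΦ0] at this
  have hright : ∀ᶠ μ in 𝓝 μ₀, Φ (Ψ μ) = μ := by
    have := (hΦ.hasStrictFDerivAt' hder (by simp)).eventually_right_inverse
    rwa [hΦ0] at this
  have hΨt : Tendsto Ψ (𝓝 μ₀) (𝓝 0) := by
    have := hΨ.continuousAt.tendsto
    rwa [hΨ0] at this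
  refine ⟨P, g ∘ Ψ, ν ∘ Ψ, hg.contDiffAt.comp _ hΨ, hν.contDiffAt.comp _ hΨ, by simp [hΨ0, hg0],
    by simp [hΨ0, hν0], hPS, fun μ => by simp [ν, hPP], ?_⟩
  filter_upwards [hright, hΨt.eventually hΦg] with μ h1 h2 a b c
  simpa [h1] using h2 a b c

/-- A smooth family of trilinear products whose derivative is everywhere given by the infinitesimal
action of locally bounded endomorphisms is locally gauge equivalent to a constant family. -/
theorem exists_gauge {μ : E → TrilinearProduct F} {U : Set E} {x₀ : E} (hU : U ∈ 𝓝 x₀)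
    (hμ : ContDiffOn ℝ ∞ μ U) {C : ℝ}
    (hκ : ∀ x ∈ U, ∀ v, ∃ κ : F →L[ℝ] F, ‖κ‖ ≤ C * ‖v‖ ∧ fderiv ℝ μ x v = infAct κ (μ x)) :
    ∃ V ⊆ U, IsOpen V ∧ x₀ ∈ V ∧ ∃ g : E → (F →L[ℝ] F), ContDiffOn ℝ ∞ g V ∧
      (∀ x ∈ V, IsUnit (g x)) ∧
      ∀ x ∈ V, ∀ a b c, g x (μ x₀ a b c) = μ x (g x a) (g x b) (g x c) := by
  have : CompleteSpace F := FiniteDimensional.complete ℝ F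
  obtain ⟨P, G, N, hG, hN, hG0, hN0, hPi, hPN, hGN⟩ := exists_slice (μ x₀)
  have hμx₀ : ContDiffAt ℝ ∞ μ x₀ := hμ.contDiffAt hU
  have hμc : Tendsto μ (𝓝 x₀) (𝓝 (μ x₀)) := hμx₀.continuousAt
  -- Slice decomposition of the family: `μ x` is `ν x` transported by `g x`. It remains to show that
  -- `ν` is constant.
  let g : E → (F →L[ℝ] F) := G ∘ μ
  let ν : E → TrilinearProduct F := N ∘ μ
  have hμs : ∀ᶠ x in 𝓝 x₀, ContDiffAt ℝ ∞ μ x := by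
    filter_upwards [eventually_mem_nhds_iff.2 hU] with x hx using hμ.contDiffAt hx
  have hgs : ∀ᶠ x in 𝓝 x₀, ContDiffAt ℝ ∞ g x := by
    filter_upwards [hμs, hμc.eventually (hG.eventually (by simp))] with x h1 h2
    exact (h2.of_le le_top).comp x h1
  have hνs : ∀ᶠ x in 𝓝 x₀, ContDiffAt ℝ ∞ ν x := by
    filter_upwards [hμs, hμc.eventually (hN.eventually (by simp))] with x h1 h2
    exact (h2.of_le le_top).comp x h1
  have hg0 : g x₀ = 1 := hG0
  have hgc : ContinuousAt g x₀ := hgs.self_of_nhds.continuousAt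
  have hu : ∀ᶠ x in 𝓝 x₀, IsUnit (g x) := by
    refine hgc.eventually (p := fun a => IsUnit a) ?_
    exact Units.isOpen.mem_nhds (by rw [hg0]; exact isUnit_one)
  have hinv : ContinuousAt (fun x => Ring.inverse (g x)) x₀ := by
    refine ContinuousAt.comp (g := Ring.inverse) ?_ hgc
    rw [hg0]
    exact (contDiffAt_ringInverse (n := 0) ℝ (1 : (F →L[ℝ] F)ˣ)).continuousAt
  have hdg : ContinuousAt (fderiv ℝ g) x₀ :=
    (hgs.self_of_nhds.fderiv_right (m := 0) (by simp)).continuousAt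
  have hK1 := hinv.norm.eventually (eventually_le_nhds (lt_add_one _))
  have hK2 := hgc.norm.eventually (eventually_le_nhds (lt_add_one _))
  have hK3 := hdg.norm.eventually (eventually_le_nhds (lt_add_one _))
  set K1 := ‖Ring.inverse (g x₀)‖ + 1 with hK1d
  set K2 := ‖g x₀‖ + 1 with hK2d
  set K3 := ‖fderiv ℝ g x₀‖ + 1 with hK3d
  have hint : ∀ᶠ x in 𝓝 x₀, ∀ a b c, g x (ν x a b c) = μ x (g x a) (g x b) (g x c) :=
    hμc.eventually hGN
  obtain ⟨r, hr, hball⟩ := Metric.eventually_nhds_iff_ball.1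
    ((show ∀ᶠ x in 𝓝 x₀, x ∈ U from hU).and <| hμs.and <| hgs.and <| hνs.and <| hu.and <| hK1.and <| hK2.and <| hK3.and <|
      eventually_eventually_nhds.2 hint)
  let c : E → TrilinearProduct F := fun x => ν x - μ x₀
  have hc : ∀ x ∈ Metric.ball x₀ r, c x = 0 := by
    -- Origin of `K`: `K1 * (C * K2 + K3) * ‖v‖` bounds the transformed endomorphism `h` below, `4`
    -- comes from `norm_infAct_le`, and `1 + ‖P‖` bounds `id - P`.
    refine eqOn_ball_zero_of_norm_fderiv_le (K := (1 + ‖P‖) * (4 * (K1 * (C * K2 + K3))))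
      (fun x hx => ?_) (by simp [c, ν, hN0]) fun x hx v => ?_
    · exact ((hball x hx).2.2.2.1.differentiableAt (by simp)).sub_const _
    · obtain ⟨hxU, h1, h2, h3, hxu, hb1, hb2, hb3, hi⟩ := hball x hx
      obtain ⟨κ, hκC, hκμ⟩ := hκ x hxU v
      have hνd := h3.differentiableAt (n := ∞) (by simp)
      have hgi (y : F) : g x (Ring.inverse (g x) y) = y :=
        DFunLike.congr_fun (Ring.mul_inverse_cancel _ hxu) y
      have hig (y : F) : Ring.inverse (g x) (g x y) = y :=
        DFunLike.congr_fun (Ring.inverse_mul_cancel _ hxu) y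
      -- The gauge transform of `κ` by `g`: the endomorphism by which `ν` moves in the direction
      -- `v`.
      let h : F →L[ℝ] F := Ring.inverse (g x) * (κ * g x - fderiv ℝ g x v)
      have hgh (y : F) : g x (h y) = κ (g x y) - fderiv ℝ g x v y := by
        simp [h, hgi]
      have hh : ‖h‖ ≤ K1 * (C * K2 + K3) * ‖v‖ := by
        have hκ2 : ‖κ * g x‖ ≤ C * ‖v‖ * K2 := by
          refine (norm_mul_le _ _).trans ?_
          have := norm_nonneg κ
          gcongr
          exact this.trans hκC
        have hg2 : ‖fderiv ℝ g x v‖ ≤ K3 * ‖v‖ := (fderiv ℝ g x).le_of_opNorm_le hb3 v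
        calc ‖h‖ ≤ ‖Ring.inverse (g x)‖ * ‖κ * g x - fderiv ℝ g x v‖ := norm_mul_le _ _
          _ ≤ K1 * (C * ‖v‖ * K2 + K3 * ‖v‖) := by
            gcongr
            exact norm_sub_le_of_le hκ2 hg2
          _ = _ := by ring
      have hdν : fderiv ℝ ν x v = infAct h (ν x) := by
        ext a b d
        have key := fderiv_intertwining (h1.differentiableAt (by simp)) hνd
          (h2.differentiableAt (by simp)) hi v a b d
        have hi0 := hi.self_of_nhds
        rw [hκμ, infAct_apply, ← hi0 a b d] at key
        have e1 := hi0 (h a) b d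
        have e2 := hi0 a (h b) d
        have e3 := hi0 a b (h d)
        rw [hgh] at e1 e2 e3
        refine (Function.LeftInverse.injective hig) ?_
        rw [infAct_apply]
        simp only [map_sub, hgh, e1, e2, e3, sub_apply]
        rw [← sub_eq_zero] at key ⊢
        rw [← key]
        abel
      have hPd : P (fderiv ℝ ν x v) = 0 := by
        have e : (fun y => P (ν y)) = fun _ => P (μ x₀) := funext fun y => hPN _
        have h0 : HasFDerivAt (fun y => P (ν y)) (0 : E →L[ℝ] TrilinearProduct F) x := by
          rw [e]
          exact hasFDerivAt_const _ x
        have := DFunLike.congr_fun ((P.hasFDerivAt.comp x hνd.hasFDerivAt).unique h0) v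
        simpa using this
      have hνc : ν x = μ x₀ + c x := by simp [c]
      -- With `ν = μ₀ + c`, the equation `P (dν) = 0` reads `infAct h μ₀ = -P (infAct h c)`, since
      -- `P` fixes `infAct h μ₀`. The inhomogeneous term is thereby replaced by one linear in `c`.
      have hdc : fderiv ℝ c x v = infAct h (c x) - P (infAct h (c x)) := by
        have e : fderiv ℝ c x = fderiv ℝ ν x := fderiv_sub_const _
        rw [hdν, hνc, infAct_add_right, map_add, hPi] at hPd
        rw [e, hdν, hνc, infAct_add_right, eq_neg_of_add_eq_zero_left hPd]
        abel
      have hb : ‖infAct h (c x)‖ ≤ 4 * (K1 * (C * K2 + K3) * ‖v‖) * ‖c x‖ :=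
        (norm_infAct_le h (c x)).trans (by gcongr)
      calc ‖fderiv ℝ c x v‖ ≤ ‖infAct h (c x)‖ + ‖P‖ * ‖infAct h (c x)‖ := by
            rw [hdc]
            exact norm_sub_le_of_le le_rfl (P.le_opNorm _)
        _ = (1 + ‖P‖) * ‖infAct h (c x)‖ := by ring
        _ ≤ (1 + ‖P‖) * (4 * (K1 * (C * K2 + K3) * ‖v‖) * ‖c x‖) := by gcongr
        _ = _ := by ring
  refine ⟨Metric.ball x₀ r, fun x hx => (hball x hx).1, Metric.isOpen_ball, Metric.mem_ball_self hr,
    g, fun x hx => (hball x hx).2.2.1.contDiffWithinAt, fun x hx => (hball x hx).2.2.2.2.1,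
    fun x hx a b d => ?_⟩
  rw [← (hball x hx).2.2.2.2.2.2.2.2.self_of_nhds, sub_eq_zero.1 (hc x hx)]

end TrilinearProduct

end Gauge

/-! ### Local sections and the local form of a connection -/

section LocalSections

variable {n : ℕ} {M : Type*} [TopologicalSpace M] [ChartedSpace (EuclideanSpace ℝ (Fin n)) M]
  {F : Type*} [NormedAddCommGroup F] [NormedSpace ℝ F]

theorem Filter.EventuallyEq.mvfderiv_eq {f g : M → F} {x : M} (h : f =ᶠ[𝓝 x] g) :
    mvfderiv (𝓡 n) f x = mvfderiv (𝓡 n) g x :=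
  ContinuousLinearMap.ext fun v => DFunLike.congr_fun h.mfderiv_eq v

theorem mvfderiv_comp_apply_eq_fderiv {G : Type*} [NormedAddCommGroup G] [NormedSpace ℝ G]
    {f : M → F} {g : F → G} {x : M} (hg : DifferentiableAt ℝ g (f x))
    (hf : MDifferentiableAt (𝓡 n) 𝓘(ℝ, F) f x) (v : TangentSpace (𝓡 n) x) :
    mvfderiv (𝓡 n) (g ∘ f) x v = fderiv ℝ g (f x) (mvfderiv (𝓡 n) f x v) := by
  refine (mfderiv_comp_apply x hg.mdifferentiableAt hf v).trans ?_
  rw [mfderiv_eq_fderiv]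
  rfl

theorem exists_smooth_bump [IsManifold (𝓡 n) ∞ M] [T2Space M] (m : M) {O : Set M} (hO : IsOpen O)
    (hm : m ∈ O) :
    ∃ (ψ : C^∞⟮𝓡 n, M; 𝓘(ℝ), ℝ⟯) (W : Set M), IsOpen W ∧ m ∈ W ∧ W ⊆ O ∧ tsupport ψ ⊆ O ∧
      ∀ x ∈ W, ψ x = 1 := by
  obtain ⟨ψ, -, hψ⟩ := (SmoothBumpFunction.nhds_basis_tsupport (I := 𝓡 n) m).mem_iff.1
    (hO.mem_nhds hm)
  obtain ⟨W, hW1, hW, hmW⟩ := mem_nhds_iff.1 (ψ.eventuallyEq_one)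
  exact ⟨⟨ψ, ψ.contMDiff⟩, W ∩ O, hW.inter hO, ⟨hmW, hm⟩, Set.inter_subset_right, hψ,
    fun x hx => hW1 hx.1⟩

variable {V : M → Type*} [TopologicalSpace (TotalSpace F V)] [∀ m, AddCommGroup (V m)]
  [∀ m, Module ℝ (V m)] [∀ m, TopologicalSpace (V m)] [FiberBundle F V] [VectorBundle ℝ F V]

theorem ContMDiffSection.sum_apply {ι : Type*} (s : Finset ι) (f : ι → Cₛ^∞⟮𝓡 n; F, V⟯) (x : M) :
    (∑ i ∈ s, f i) x = ∑ i ∈ s, f i x := by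
  have := congrFun (map_sum (ContMDiffSection.coeAddHom (𝓡 n) F ∞ V) f s) x
  rwa [Finset.sum_apply] at this

theorem LinearConnection.nabla_sum [IsManifold (𝓡 n) ∞ M] (D : LinearConnection n F V) (X)
    {ι : Type*} (s : Finset ι) (f : ι → Cₛ^∞⟮𝓡 n; F, V⟯) :
    D.nabla X (∑ i ∈ s, f i) = ∑ i ∈ s, D.nabla X (f i) :=
  map_sum (AddMonoidHom.mk' (D.nabla X) (D.add_section X)) f s

variable [ContMDiffVectorBundle ∞ F V (𝓡 n)]

theorem contMDiffOn_linearMapAt_section (e : Trivialization F (π F V)) [MemTrivializationAtlas e]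
    (u : Cₛ^∞⟮𝓡 n; F, V⟯) :
    ContMDiffOn (𝓡 n) 𝓘(ℝ, F) ∞ (fun x => e.linearMapAt ℝ x (u x)) e.baseSet := by
  refine ((e.contMDiffOn_section_baseSet_iff).1 u.contMDiff.contMDiffOn).congr fun x hx => ?_
  rw [e.coe_linearMapAt_of_mem hx]

/-- A cut-off of the section that is constant in a local trivialization. -/
noncomputable def cutoffSection (e : Trivialization F (π F V)) [MemTrivializationAtlas e]
    (ψ : C^∞⟮𝓡 n, M; 𝓘(ℝ), ℝ⟯) (hψ : tsupport ψ ⊆ e.baseSet) (f : F) : Cₛ^∞⟮𝓡 n; F, V⟯ :=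
  ⟨(ψ : M → ℝ) • fun x => e.symmₗ ℝ x f,
    ContMDiffOn.smul_section_of_tsupport ψ.contMDiff.contMDiffOn e.open_baseSet hψ <| by
      rw [e.contMDiffOn_section_baseSet_iff]
      refine (contMDiffOn_const (c := f)).congr fun y hy => ?_
      rw [e.symmₗ_apply hy, e.apply_mk_symm hy]⟩

theorem cutoffSection_apply (e : Trivialization F (π F V)) [MemTrivializationAtlas e]
    (ψ : C^∞⟮𝓡 n, M; 𝓘(ℝ), ℝ⟯) (hψ : tsupport ψ ⊆ e.baseSet) (f : F) (x : M) :
    cutoffSection e ψ hψ f x = ψ x • e.symmₗ ℝ x f := rfl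

variable [IsManifold (𝓡 n) ∞ M] [T2Space M]

/-- The product and the connection accept only global sections, so constant local sections are cut
off; a single bump function makes `W` independent of `f`. -/
theorem exists_locally_constant_sections (e : Trivialization F (π F V)) [MemTrivializationAtlas e]
    {m : M} (hm : m ∈ e.baseSet) :
    ∃ (W : Set M) (σ : F → Cₛ^∞⟮𝓡 n; F, V⟯), IsOpen W ∧ m ∈ W ∧ W ⊆ e.baseSet ∧
      ∀ x ∈ W, ∀ f, σ f x = e.symmₗ ℝ x f := by
  obtain ⟨ψ, W, hW, hmW, hWe, hψ, h1⟩ := exists_smooth_bump (n := n) m e.open_baseSet hm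
  refine ⟨W, cutoffSection e ψ hψ, hW, hmW, hWe, fun x hx f => ?_⟩
  rw [cutoffSection_apply, h1 x hx, one_smul]

variable [FiniteDimensional ℝ F]

/-- In a local trivialization, `∇_X = Γ + d_X`. -/
theorem LinearConnection.exists_local_form (D : LinearConnection n F V)
    (e : Trivialization F (π F V)) [MemTrivializationAtlas e] {m : M} (hm : m ∈ e.baseSet) :
    ∃ W : Set M, IsOpen W ∧ m ∈ W ∧ W ⊆ e.baseSet ∧ ∀ X, ∃ Γ : M → (F →L[ℝ] F), ContinuousAt Γ m ∧
      ∀ x ∈ W, ∀ u : Cₛ^∞⟮𝓡 n; F, V⟯, e.linearMapAt ℝ x (D.nabla X u x) =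
        Γ x (e.linearMapAt ℝ x (u x)) +
          mvfderiv (𝓡 n) (fun y => e.linearMapAt ℝ y (u y)) x (X x) := by
  obtain ⟨ψ, W, hW, hmW, hWe, hψ, h1⟩ := exists_smooth_bump (n := n) m e.open_baseSet hm
  let b := Module.finBasis ℝ F
  let ℓ (i) : F →L[ℝ] ℝ := (b.coord i).toContinuousLinearMap
  have hℓ (f : F) : ∑ i, ℓ i f • b i = f := b.sum_repr f
  let S (i) : Cₛ^∞⟮𝓡 n; F, V⟯ := cutoffSection e ψ hψ (b i)
  -- `Γ` sends the basis vector `b i` to the trivialized derivative of the cut-off frame section `S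
  -- i`.
  refine ⟨W, hW, hmW, hWe, fun X => ⟨fun x => ∑ i, (ℓ i).smulRight
    (e.linearMapAt ℝ x (D.nabla X (S i) x)), ?_, fun x hx u => ?_⟩⟩
  · refine tendsto_finsetSum _ fun i _ => ?_
    have : ContinuousAt (fun x => e.linearMapAt ℝ x (D.nabla X (S i) x)) m :=
      ((contMDiffOn_linearMapAt_section e _).contMDiffAt
        (e.open_baseSet.mem_nhds hm)).continuousAt
    exact ((ContinuousLinearMap.smulRightL ℝ F F (ℓ i)).continuous.continuousAt).comp this
  · have hxe := hWe hx
    let û : M → F := fun y => e.linearMapAt ℝ y (u y)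
    have hû : ContMDiffOn (𝓡 n) 𝓘(ℝ, F) ∞ û e.baseSet := contMDiffOn_linearMapAt_section e u
    let c (i) : C^∞⟮𝓡 n, M; 𝓘(ℝ), ℝ⟯ :=
      ⟨fun y => ψ y • ℓ i (û y), by
        refine contMDiff_of_tsupport fun y hy => ?_
        have hy' : y ∈ e.baseSet := hψ (closure_mono (Function.support_smul_subset_left _ _) hy)
        exact ψ.contMDiff.contMDiffAt.smul ((ℓ i).contMDiff.contMDiffAt.comp y
          (hû.contMDiffAt (e.open_baseSet.mem_nhds hy')))⟩
    -- One factor `ψ` makes the coefficients global functions, the other makes the frame global. As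
    -- `ψ = 1` on `W`, applying `∇_X` to this global identity also yields the locality of the
    -- connection there.
    have key : (ψ * ψ) • u = ∑ i, c i • S i := by
      ext y
      rw [ContMDiffSection.sum_apply]
      change (ψ y * ψ y) • u y = ∑ i, (ψ y • ℓ i (û y)) • ψ y • e.symmₗ ℝ y (b i)
      by_cases hy : y ∈ e.baseSet
      · have : u y = ∑ i, ℓ i (û y) • e.symmₗ ℝ y (b i) := by
          have h2 : u y = e.symmₗ ℝ y (û y) := (e.symmₗ_linearMapAt hy (u y)).symm
          conv_lhs => rw [h2, ← hℓ (û y), map_sum]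
          simp only [map_smul]
        conv_lhs => rw [this]
        rw [Finset.smul_sum]
        refine Finset.sum_congr rfl fun i _ => ?_
        simp only [smul_smul, smul_eq_mul]
        congr 1
        ring
      · have : ψ y = 0 := image_eq_zero_of_notMem_tsupport fun h => hy (hψ h)
        simp [this]
    have hdψ : mvfderiv (𝓡 n) (ψ * ψ : C^∞⟮𝓡 n, M; 𝓘(ℝ), ℝ⟯) x = 0 := by
      have : (ψ * ψ : C^∞⟮𝓡 n, M; 𝓘(ℝ), ℝ⟯) =ᶠ[𝓝 x] fun _ : M => (1 : ℝ) := by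
        filter_upwards [hW.mem_nhds hx] with y hy
        simp [h1 y hy]
      rw [this.mvfderiv_eq, mvfderiv_const]
    have hdc (i) : mvfderiv (𝓡 n) (c i) x (X x) = ℓ i (mvfderiv (𝓡 n) û x (X x)) := by
      have : c i =ᶠ[𝓝 x] ℓ i ∘ û := by
        filter_upwards [hW.mem_nhds hx] with y hy
        simp [c, h1 y hy]
      rw [this.mvfderiv_eq]
      have hd : MDifferentiableAt (𝓡 n) 𝓘(ℝ, F) û x :=
        (hû.contMDiffAt (e.open_baseSet.mem_nhds hxe)).mdifferentiableAt (by simp)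
      rw [mvfderiv_comp_apply_eq_fderiv (ℓ i).differentiableAt hd, (ℓ i).fderiv]
    have h2 := congrArg (fun s : Cₛ^∞⟮𝓡 n; F, V⟯ => s x) (congrArg (D.nabla X) key)
    simp only [D.nabla_sum, ContMDiffSection.sum_apply, D.leibniz, hdψ] at h2
    have h3 := congrArg (e.linearMapAt ℝ x) h2
    have hψx : ψ x = 1 := h1 x hx
    have hψψ : (ψ * ψ) x = 1 := by simp [hψx]
    have hcx (i) : c i x = ℓ i (û x) := by simp [c, hψx]
    simp only [map_sum, map_add, map_smul, hdc, S, cutoffSection_apply, hψx, hψψ, hcx,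
      e.linearMapAt_symmₗ hxe, one_smul, zero_apply, zero_smul, add_zero,
      Finset.sum_add_distrib, hℓ] at h3
    simpa using h3

end LocalSections

/-! ### Para-associative algebroids in local coordinates -/

namespace ParaAssociativeAlgebra

variable {F B : Type*} [NormedAddCommGroup F] [NormedSpace ℝ F] [FiniteDimensional ℝ F]
  [AddCommGroup B] [Module ℝ B]

/-- The trilinear product `(x, y, z) ↦ l [s x, s y, s z]` on a finite-dimensional space. -/
noncomputable def toTrilinearProduct (ℬ : ParaAssociativeAlgebra ℝ B) (s : F →ₗ[ℝ] B)
    (l : B →ₗ[ℝ] F) : TrilinearProduct F :=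
  LinearMap.toContinuousLinearMap
    { toFun x := LinearMap.toContinuousLinearMap
        { toFun y := LinearMap.toContinuousLinearMap
            { toFun z := l (ℬ.prod (s x) (s y) (s z))
              map_add' z z' := by rw [map_add, ℬ.add_right, map_add]
              map_smul' r z := by rw [map_smul, ℬ.smul_right, map_smul, RingHom.id_apply] }
          map_add' y y' := by
            ext z
            change l (ℬ.prod _ (s (y + y')) _) = l _ + l _
            rw [map_add, ℬ.add_mid, map_add]
          map_smul' r y := by
            ext z
            change l (ℬ.prod _ (s (r • y)) _) = r • l _
            rw [map_smul, ℬ.smul_mid, map_smul] }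
      map_add' x x' := by
        ext y z
        change l (ℬ.prod (s (x + x')) _ _) = l _ + l _
        rw [map_add, ℬ.add_left, map_add]
      map_smul' r x := by
        ext y z
        change l (ℬ.prod (s (r • x)) _ _) = r • l _
        rw [map_smul, ℬ.smul_left, map_smul] }

theorem toTrilinearProduct_apply (ℬ : ParaAssociativeAlgebra ℝ B) (s : F →ₗ[ℝ] B)
    (l : B →ₗ[ℝ] F) (x y z : F) :
    ℬ.toTrilinearProduct s l x y z = l (ℬ.prod (s x) (s y) (s z)) := rfl

/-- Transport of a para-associative algebra along a linear isomorphism. -/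
def transport {R A B : Type*} [CommRing R] [AddCommGroup A] [Module R A] [AddCommGroup B]
    [Module R B] (𝒜 : ParaAssociativeAlgebra R A) (φ : A ≃ₗ[R] B) :
    ParaAssociativeAlgebra R B where
  prod x y z := φ (𝒜.prod (φ.symm x) (φ.symm y) (φ.symm z))
  add_left _ _ _ _ := by rw [map_add, 𝒜.add_left, map_add]
  add_mid _ _ _ _ := by rw [map_add, 𝒜.add_mid, map_add]
  add_right _ _ _ _ := by rw [map_add, 𝒜.add_right, map_add]
  smul_left _ _ _ _ := by rw [map_smul, 𝒜.smul_left, map_smul]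
  smul_mid _ _ _ _ := by rw [map_smul, 𝒜.smul_mid, map_smul]
  smul_right _ _ _ _ := by rw [map_smul, 𝒜.smul_right, map_smul]
  para_left_mid _ _ _ _ _ := by simp only [φ.symm_apply_apply, 𝒜.para_left_mid]
  para_mid_right _ _ _ _ _ := by simp only [φ.symm_apply_apply, 𝒜.para_mid_right]

end ParaAssociativeAlgebra

/-! ### Derivatives and coordinate fields in a chart -/

section Chart

variable {n : ℕ} {M : Type*} [TopologicalSpace M] [ChartedSpace (EuclideanSpace ℝ (Fin n)) M]
  [IsManifold (𝓡 n) ∞ M] {F : Type*} [NormedAddCommGroup F] [NormedSpace ℝ F]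

theorem mvfderiv_eq_fderiv_extChartAt {f : M → F} {m x : M} (hx : x ∈ (chartAt (EuclideanSpace ℝ (Fin n)) m).source)
    (hf : MDifferentiableAt (𝓡 n) 𝓘(ℝ, F) f x) (w : TangentSpace (𝓡 n) x) :
    mvfderiv (𝓡 n) f x w = fderiv ℝ (f ∘ (extChartAt (𝓡 n) m).symm) (extChartAt (𝓡 n) m x)
      (mfderiv (𝓡 n) 𝓘(ℝ, EuclideanSpace ℝ (Fin n)) (extChartAt (𝓡 n) m) x w) := by
  have : IsManifold (𝓡 n) 1 M := .of_le (n := ∞) (by simp)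
  have hx' : x ∈ (extChartAt (𝓡 n) m).source := by rwa [extChartAt_source]
  have h1 : f =ᶠ[𝓝 x] (f ∘ (extChartAt (𝓡 n) m).symm) ∘ extChartAt (𝓡 n) m := by
    filter_upwards [extChartAt_source_mem_nhds' hx'] with y hy
    exact congrArg f ((extChartAt (𝓡 n) m).left_inv hy).symm
  have hφ : MDifferentiableAt (𝓡 n) 𝓘(ℝ, EuclideanSpace ℝ (Fin n)) (extChartAt (𝓡 n) m) x :=
    mdifferentiableAt_extChartAt hx
  have hs : MDifferentiableAt 𝓘(ℝ, EuclideanSpace ℝ (Fin n)) (𝓡 n) (extChartAt (𝓡 n) m).symm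
      (extChartAt (𝓡 n) m x) :=
    ((contMDiffOn_extChartAt_symm (n := 1) m).contMDiffAt
      ((isOpen_extChartAt_target m).mem_nhds ((extChartAt (𝓡 n) m).map_source hx'))).mdifferentiableAt (by simp)
  have hd : DifferentiableAt ℝ (f ∘ (extChartAt (𝓡 n) m).symm) (extChartAt (𝓡 n) m x) := by
    rw [← mdifferentiableAt_iff_differentiableAt]
    refine MDifferentiableAt.comp (I' := 𝓡 n) _ ?_ hs
    rwa [(extChartAt (𝓡 n) m).left_inv hx']
  rw [h1.mvfderiv_eq]
  exact mvfderiv_comp_apply_eq_fderiv hd hφ w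

/-- On the chart domain the tangent bundle trivialization at `m` is the derivative of the chart, so
its cut-off constant sections are global fields that agree with coordinate fields near `m`. -/
theorem exists_coordinate_fields [T2Space M] (m : M) :
    ∃ (W : Set M) (X : EuclideanSpace ℝ (Fin n) →
        Cₛ^∞⟮𝓡 n; EuclideanSpace ℝ (Fin n), (TangentSpace (𝓡 n) : M → Type _)⟯),
      IsOpen W ∧ m ∈ W ∧ W ⊆ (chartAt (EuclideanSpace ℝ (Fin n)) m).source ∧ ∀ x ∈ W, ∀ v,
        mfderiv (𝓡 n) 𝓘(ℝ, EuclideanSpace ℝ (Fin n)) (extChartAt (𝓡 n) m) x (X v x) = v := by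
  have : IsManifold (𝓡 n) 1 M := .of_le (n := ∞) (by simp)
  have : IsManifold (𝓡 n) (∞ + 1) M := ‹IsManifold (𝓡 n) ∞ M›
  let e := trivializationAt (EuclideanSpace ℝ (Fin n)) (TangentSpace (𝓡 n) : M → Type _) m
  obtain ⟨W, σ, hW, hmW, hWe, hσ⟩ := exists_locally_constant_sections (n := n) e
    (FiberBundle.mem_baseSet_trivializationAt' m)
  refine ⟨W, σ, hW, hmW, hWe, fun x hx v => ?_⟩
  rw [← TangentBundle.continuousLinearMapAt_trivializationAt (hWe hx), hσ x hx]
  exact (trivializationAt (EuclideanSpace ℝ (Fin n)) (TangentSpace (𝓡 n) : M → Type _)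
    m).linearMapAt_symmₗ (R := ℝ) (hWe hx) v

theorem ContMDiffOn.contDiffOn_comp_extChartAt_symm {f : M → F} {W : Set M}
    (hf : ContMDiffOn (𝓡 n) 𝓘(ℝ, F) ∞ f W) (m : M) :
    ContDiffOn ℝ ∞ (f ∘ (extChartAt (𝓡 n) m).symm)
      ((extChartAt (𝓡 n) m).target ∩ (extChartAt (𝓡 n) m).symm ⁻¹' W) := by
  rw [← contMDiffOn_iff_contDiffOn]
  exact hf.comp ((contMDiffOn_extChartAt_symm m).mono Set.inter_subset_left) fun x hx => hx.2

end Chart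

/-! ### The Leibniz rule as an equation for the local product -/

section LocalProduct

variable {n : ℕ} {M : Type*} [TopologicalSpace M] [ChartedSpace (EuclideanSpace ℝ (Fin n)) M]
  [IsManifold (𝓡 n) ∞ M] [T2Space M]
  {F : Type*} [NormedAddCommGroup F] [NormedSpace ℝ F] [FiniteDimensional ℝ F]
  {V : M → Type*} [TopologicalSpace (TotalSpace F V)] [∀ m, AddCommGroup (V m)]
  [∀ m, Module ℝ (V m)] [∀ m, TopologicalSpace (V m)] [FiberBundle F V] [VectorBundle ℝ F V]
  [ContMDiffVectorBundle ∞ F V (𝓡 n)]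

/-- The fibre products of a para-associative algebroid, read in a local trivialization. -/
noncomputable def ParaAssociativeAlgebroid.localProduct (A : ParaAssociativeAlgebroid n F V)
    (e : Trivialization F (π F V)) [MemTrivializationAtlas e] (x : M) : TrilinearProduct F :=
  (A.fibre x).toTrilinearProduct (e.symmₗ ℝ x) (e.linearMapAt ℝ x)

theorem ParaAssociativeAlgebroid.localProduct_apply_linearMapAt
    (A : ParaAssociativeAlgebroid n F V) (e : Trivialization F (π F V)) [MemTrivializationAtlas e]
    {x : M} (hx : x ∈ e.baseSet) (α β γ : V x) :
    A.localProduct e x (e.linearMapAt ℝ x α) (e.linearMapAt ℝ x β) (e.linearMapAt ℝ x γ) =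
      e.linearMapAt ℝ x ((A.fibre x).prod α β γ) := by
  simp only [localProduct, ParaAssociativeAlgebra.toTrilinearProduct_apply, e.symmₗ_linearMapAt hx]

/-- The local product is smooth, and its derivatives in the chart at `m` are given by the
infinitesimal action of endomorphisms continuous at `m`. -/
theorem ParaAssociativeAlgebroid.exists_localProduct_smooth (A : ParaAssociativeAlgebroid n F V)
    {D : LinearConnection n F V} (hD : D.IsDifferential A)
    (e : Trivialization F (π F V)) [MemTrivializationAtlas e] {m : M} (hm : m ∈ e.baseSet) :
    ∃ W : Set M, IsOpen W ∧ m ∈ W ∧ W ⊆ e.baseSet ∧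
      W ⊆ (chartAt (EuclideanSpace ℝ (Fin n)) m).source ∧
      (∀ a b c, ContMDiffOn (𝓡 n) 𝓘(ℝ, F) ∞ (fun x => A.localProduct e x a b c) W) ∧
      ∀ v, ∃ Γ : M → (F →L[ℝ] F), ContinuousAt Γ m ∧ ∀ x ∈ W, ∀ a b c,
        fderiv ℝ ((fun y => A.localProduct e y a b c) ∘ (extChartAt (𝓡 n) m).symm)
          (extChartAt (𝓡 n) m x) v = (A.localProduct e x).infAct (Γ x) a b c := by
  obtain ⟨W₁, X, hW₁, hmW₁, hW₁c, hX⟩ := exists_coordinate_fields (n := n) m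
  obtain ⟨W₂, σ, hW₂, hmW₂, hW₂e, hσ⟩ := exists_locally_constant_sections (n := n) e hm
  obtain ⟨W₃, hW₃, hmW₃, hW₃e, hΓ⟩ := D.exists_local_form e hm
  have hσL {x} (hx : x ∈ W₂) (a : F) : e.linearMapAt ℝ x (σ a x) = a := by
    rw [hσ x hx, e.linearMapAt_symmₗ (hW₂e hx)]
  have hμ {x} (hx : x ∈ W₂) (a b c : F) : A.localProduct e x a b c =
      e.linearMapAt ℝ x (A.prod (σ a) (σ b) (σ c) x) := by
    rw [← A.fibre_prod_apply, hσ x hx, hσ x hx, hσ x hx]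
    rfl
  have hsm (a b c) : ContMDiffOn (𝓡 n) 𝓘(ℝ, F) ∞ (fun x => A.localProduct e x a b c) W₂ :=
    ((contMDiffOn_linearMapAt_section e (A.prod (σ a) (σ b) (σ c))).mono hW₂e).congr
      fun x hx => hμ hx a b c
  refine ⟨W₁ ∩ (W₂ ∩ W₃), hW₁.inter (hW₂.inter hW₃), ⟨hmW₁, hmW₂, hmW₃⟩,
    fun x hx => hW₂e hx.2.1, fun x hx => hW₁c hx.1,
    fun a b c => (hsm a b c).mono fun x hx => hx.2.1, fun v => ?_⟩
  obtain ⟨Γ, hΓc, hΓe⟩ := hΓ (X v)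
  -- The Leibniz rule gives `Γ[a,b,c] + d[a,b,c] = [Γa,b,c] + [a,Γb,c] + [a,b,Γc]`; solving for
  -- `d[a,b,c]` produces the sign.
  refine ⟨fun x => -Γ x, hΓc.neg, fun x ⟨hx₁, hx₂, hx₃⟩ a b c => ?_⟩
  have hxe := hW₂e hx₂
  have hd : MDifferentiableAt (𝓡 n) 𝓘(ℝ, F) (fun y => A.localProduct e y a b c) x :=
    ((hsm a b c).contMDiffAt (hW₂.mem_nhds hx₂)).mdifferentiableAt (by simp)
  have h1 := mvfderiv_eq_fderiv_extChartAt (hW₁c hx₁) hd (X v x)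
  rw [hX x hx₁] at h1
  rw [← h1]
  have h2 : (fun y => e.linearMapAt ℝ y (A.prod (σ a) (σ b) (σ c) y)) =ᶠ[𝓝 x]
      fun y => A.localProduct e y a b c := by
    filter_upwards [hW₂.mem_nhds hx₂] with y hy using (hμ hy a b c).symm
  have h3 := hΓe x hx₃ (A.prod (σ a) (σ b) (σ c))
  have hσd (a : F) : e.linearMapAt ℝ x (D.nabla (X v) (σ a) x) = Γ x a := by
    have : (fun y => e.linearMapAt ℝ y (σ a y)) =ᶠ[𝓝 x] fun _ => a := by
      filter_upwards [hW₂.mem_nhds hx₂] with y hy using hσL hy a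
    rw [hΓe x hx₃, hσL hx₂, this.mvfderiv_eq, mvfderiv_const]
    simp
  rw [h2.mvfderiv_eq, hD, ← hμ hx₂] at h3
  simp only [ContMDiffSection.coe_add, Pi.add_apply, map_add, ← A.fibre_prod_apply,
    ← A.localProduct_apply_linearMapAt e hxe, hσd, hσL hx₂] at h3
  rw [TrilinearProduct.infAct_apply]
  simp only [neg_apply, map_neg]
  rw [eq_sub_of_add_eq' h3.symm]
  abel

end LocalProduct

/-! ### Trivializing the fibre algebras -/

section Trivializing

variable {n : ℕ} {M : Type*} [TopologicalSpace M] [ChartedSpace (EuclideanSpace ℝ (Fin n)) M]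
  {F : Type*} [NormedAddCommGroup F] [NormedSpace ℝ F]
  {V : M → Type*} [TopologicalSpace (TotalSpace F V)]

/-- A local trivialization followed by a continuous family of linear automorphisms. -/
noncomputable def Bundle.Trivialization.transFiberwiseLinear (e : Trivialization F (π F V))
    (G : M → F ≃L[ℝ] F) {W : Set M} (hW : IsOpen W) (hWe : W ⊆ e.baseSet)
    (hG : ContinuousOn (fun x => (G x : F →L[ℝ] F)) W)
    (hG' : ContinuousOn (fun x => ((G x).symm : F →L[ℝ] F)) W) :
    Trivialization F (π F V) where
  toOpenPartialHomeomorph :=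
    e.toOpenPartialHomeomorph.trans (FiberwiseLinear.openPartialHomeomorph G hW hG hG')
  baseSet := W
  open_baseSet := hW
  source_eq := by
    ext p
    rw [OpenPartialHomeomorph.trans_source]
    constructor
    · rintro ⟨hp, hp'⟩
      have := hp'.1
      rwa [e.coe_coe, e.coe_fst hp] at this
    · intro hp
      have hps : p ∈ e.source := e.mem_source.2 (hWe hp)
      refine ⟨hps, ?_, Set.mem_univ _⟩
      rwa [e.coe_coe, e.coe_fst hps]
  target_eq := by
    ext p
    rw [OpenPartialHomeomorph.trans_target]
    exact ⟨fun h => h.1, fun h => ⟨h, e.mem_target.2 (hWe h.1)⟩⟩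
  proj_toFun p hp := e.coe_fst hp.1

theorem Bundle.Trivialization.transFiberwiseLinear_apply (e : Trivialization F (π F V))
    (G : M → F ≃L[ℝ] F) {W : Set M} (hW : IsOpen W) (hWe : W ⊆ e.baseSet)
    (hG : ContinuousOn (fun x => (G x : F →L[ℝ] F)) W)
    (hG' : ContinuousOn (fun x => ((G x).symm : F →L[ℝ] F)) W) (p : TotalSpace F V) :
    e.transFiberwiseLinear G hW hWe hG hG' p = ((e p).1, G (e p).1 (e p).2) := rfl

variable [∀ m, AddCommGroup (V m)] [∀ m, Module ℝ (V m)] [∀ m, TopologicalSpace (V m)]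
  [FiberBundle F V] [VectorBundle ℝ F V] [ContMDiffVectorBundle ∞ F V (𝓡 n)]

theorem Bundle.Trivialization.contMDiffOn_transFiberwiseLinear (e : Trivialization F (π F V))
    [MemTrivializationAtlas e] (G : M → F ≃L[ℝ] F) {W : Set M} (hW : IsOpen W)
    (hWe : W ⊆ e.baseSet)
    (hG : ContMDiffOn (𝓡 n) 𝓘(ℝ, F →L[ℝ] F) ∞ (fun x => (G x : F →L[ℝ] F)) W)
    (hG' : ContMDiffOn (𝓡 n) 𝓘(ℝ, F →L[ℝ] F) ∞ (fun x => ((G x).symm : F →L[ℝ] F)) W) :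
    ContMDiffOn ((𝓡 n).prod 𝓘(ℝ, F)) ((𝓡 n).prod 𝓘(ℝ, F)) ∞
        (e.transFiberwiseLinear G hW hWe hG.continuousOn hG'.continuousOn)
        (e.transFiberwiseLinear G hW hWe hG.continuousOn hG'.continuousOn).source ∧
      ContMDiffOn ((𝓡 n).prod 𝓘(ℝ, F)) ((𝓡 n).prod 𝓘(ℝ, F)) ∞
        (e.transFiberwiseLinear G hW hWe hG.continuousOn hG'.continuousOn).toOpenPartialHomeomorph.symm
        (e.transFiberwiseLinear G hW hWe hG.continuousOn hG'.continuousOn).target := by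
  have h (H : M → F →L[ℝ] F) (hH : ContMDiffOn (𝓡 n) 𝓘(ℝ, F →L[ℝ] F) ∞ H W) :
      ContMDiffOn ((𝓡 n).prod 𝓘(ℝ, F)) ((𝓡 n).prod 𝓘(ℝ, F)) ∞
        (fun p : M × F => (p.1, H p.1 p.2)) (W ×ˢ Set.univ) :=
    contMDiffOn_fst.prodMk
      ((hH.comp contMDiffOn_fst fun p hp => hp.1).clm_apply contMDiffOn_snd)
  exact ⟨(h _ hG).comp (e.contMDiffOn.mono fun p hp => hp.1) fun p hp => hp.2,
    e.contMDiffOn_symm.comp ((h _ hG').mono fun p hp => hp.1) fun p hp => hp.2⟩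

end Trivializing

/-! ### Algebra bundle charts and isomorphism of the fibres -/

section Main

variable {n : ℕ} {M : Type*} [TopologicalSpace M] [ChartedSpace (EuclideanSpace ℝ (Fin n)) M]
  [IsManifold (𝓡 n) ∞ M] [T2Space M]
  {F : Type*} [NormedAddCommGroup F] [NormedSpace ℝ F] [FiniteDimensional ℝ F]
  {V : M → Type*} [TopologicalSpace (TotalSpace F V)] [∀ m, AddCommGroup (V m)]
  [∀ m, Module ℝ (V m)] [∀ m, TopologicalSpace (V m)] [FiberBundle F V] [VectorBundle ℝ F V]
  [ContMDiffVectorBundle ∞ F V (𝓡 n)]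

/-- Near `m`, a smooth gauge transformation makes the local product constant. -/
theorem ParaAssociativeAlgebroid.exists_smooth_gauge (A : ParaAssociativeAlgebroid n F V)
    {D : LinearConnection n F V} (hD : D.IsDifferential A)
    (e : Trivialization F (π F V)) [MemTrivializationAtlas e] {m : M} (hm : m ∈ e.baseSet) :
    ∃ (W : Set M) (G : M → F ≃L[ℝ] F), IsOpen W ∧ m ∈ W ∧ W ⊆ e.baseSet ∧
      ContMDiffOn (𝓡 n) 𝓘(ℝ, F →L[ℝ] F) ∞ (fun x => (G x : F →L[ℝ] F)) W ∧
      ContMDiffOn (𝓡 n) 𝓘(ℝ, F →L[ℝ] F) ∞ (fun x => ((G x).symm : F →L[ℝ] F)) W ∧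
      ∀ x ∈ W, ∀ a b c, G x (A.localProduct e x a b c) =
        A.localProduct e m (G x a) (G x b) (G x c) := by
  have : CompleteSpace F := FiniteDimensional.complete ℝ F
  obtain ⟨W, hW, hmW, hWe, hWc, hsm, hΓ⟩ := A.exists_localProduct_smooth hD e hm
  let φ := extChartAt (𝓡 n) m
  let μ : EuclideanSpace ℝ (Fin n) → TrilinearProduct F := A.localProduct e ∘ φ.symm
  let β := (EuclideanSpace.basisFun (Fin n) ℝ)
  choose Γ hΓc hΓe using fun i => hΓ (β i)
  have hφm : φ.symm (φ m) = m := extChartAt_to_inv m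
  -- Each `Γ i` is known to be continuous only at `m`, which still bounds it near `m`. The set `U`
  -- below is accordingly a neighbourhood that need not be open.
  have hbd : ∃ C, ∀ᶠ x in 𝓝 m, ∀ i, ‖Γ i x‖ ≤ C := by
    refine ⟨∑ i, (‖Γ i m‖ + 1), eventually_all.2 fun i => ?_⟩
    filter_upwards [(hΓc i).norm.eventually (eventually_le_nhds (lt_add_one _))] with x hx
    exact hx.trans (Finset.single_le_sum (f := fun i => ‖Γ i m‖ + 1)
      (fun i _ => by positivity) (Finset.mem_univ i))
  obtain ⟨C, hC⟩ := hbd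
  have hsymm : Tendsto φ.symm (𝓝 (φ m)) (𝓝 m) := by
    have := continuousAt_extChartAt_symm (I := 𝓡 n) m
    rwa [ContinuousAt, extChartAt_to_inv] at this
  let U : Set (EuclideanSpace ℝ (Fin n)) :=
    {y | y ∈ φ.target ∩ φ.symm ⁻¹' W ∧ ∀ i, ‖Γ i (φ.symm y)‖ ≤ C}
  have hU : U ∈ 𝓝 (φ m) := by
    filter_upwards [extChartAt_target_mem_nhds (I := 𝓡 n) m, hsymm.eventually (hW.mem_nhds hmW),
      hsymm.eventually hC] with y h1 h2 h3 using ⟨⟨h1, h2⟩, h3⟩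
  have hμO : ContDiffOn ℝ ∞ μ (φ.target ∩ φ.symm ⁻¹' W) :=
    TrilinearProduct.contDiffOn_of_apply fun a b c =>
      (hsm a b c).contDiffOn_comp_extChartAt_symm m
  have hO : IsOpen (φ.target ∩ φ.symm ⁻¹' W) :=
    (continuousOn_extChartAt_symm m).isOpen_inter_preimage (isOpen_extChartAt_target m) hW
  have hder : ∀ y ∈ U, ∀ i, fderiv ℝ μ y (β i) = TrilinearProduct.infAct (Γ i (φ.symm y)) (μ y) := by
    intro y hy i
    ext a b c
    have hd : HasFDerivAt μ (fderiv ℝ μ y) y :=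
      ((hμO.contDiffAt (hO.mem_nhds hy.1)).differentiableAt (by simp)).hasFDerivAt
    have h0 (d : F) := hasFDerivAt_const (𝕜 := ℝ) d y
    have h1 := (((hd.clm_apply (h0 a)).clm_apply (h0 b)).clm_apply (h0 c)).fderiv
    have h2 := hΓe i (φ.symm y) hy.1.2 a b c
    rw [φ.right_inv hy.1.1] at h2
    have h3 := DFunLike.congr_fun h1 (β i)
    refine Eq.trans ?_ h2
    refine Eq.trans ?_ h3.symm
    simp
  obtain ⟨V', hV'U, hV', hmV', g, hg, hgu, hgμ⟩ := TrilinearProduct.exists_gauge hU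
    (hμO.mono fun y hy => hy.1) (C := n * C) fun y hy v => by
      -- The infinitesimal action is linear in the endomorphism, so the basis directions suffice;
      -- each `|v i| ≤ ‖v‖`, whence the factor `n` in the constant.
      refine ⟨∑ i, v i • Γ i (φ.symm y), ?_, ?_⟩
      · calc ‖∑ i, v i • Γ i (φ.symm y)‖ ≤ ∑ i : Fin n, C * ‖v‖ := by
              refine norm_sum_le_of_le _ fun i _ => ?_
              rw [norm_smul, mul_comm]
              gcongr
              · exact (norm_nonneg _).trans (hy.2 i)
              · exact hy.2 i
              · exact PiLp.norm_apply_le v i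
          _ = n * C * ‖v‖ := by simp [mul_assoc]
      · rw [← TrilinearProduct.infActₗ_apply]
        simp only [map_sum, map_smul, TrilinearProduct.infActₗ_apply, ← hder y hy]
        conv_lhs => rw [← β.sum_repr v]
        simp [β]
  have hμm : μ (φ m) = A.localProduct e m := congrArg (A.localProduct e) hφm
  -- `g` carries the product at `m` to the product at `x`, so the trivialization is corrected by its
  -- inverse; the value off the units is irrelevant.
  let G : M → F ≃L[ℝ] F := fun x => open scoped Classical in
    if h : IsUnit (g (φ x)) then ContinuousLinearEquiv.unitsEquiv ℝ F h.unit⁻¹ else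
      ContinuousLinearEquiv.refl ℝ F
  let W' : Set M := φ.source ∩ φ ⁻¹' V'
  have hG {x} (hx : x ∈ W') : (G x : F →L[ℝ] F) = Ring.inverse (g (φ x)) := by
    have hu := hgu _ hx.2
    simp only [G, dif_pos hu, Ring.inverse_of_isUnit hu]
    rfl
  have hG' {x} (hx : x ∈ W') : ((G x).symm : F →L[ℝ] F) = g (φ x) := by
    have hu := hgu _ hx.2
    simp only [G, dif_pos hu]
    rfl
  have hW'n : ContMDiffOn (𝓡 n) 𝓘(ℝ, F →L[ℝ] F) ∞ (fun x => g (φ x)) W' :=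
    hg.contMDiffOn.comp ((contMDiffOn_extChartAt (n := ∞)).mono fun x hx => by
      simpa [φ] using hx.1) fun x hx => hx.2
  refine ⟨W', G, (continuousOn_extChartAt m).isOpen_inter_preimage (isOpen_extChartAt_source m) hV',
    ⟨mem_extChartAt_source m, hmV'⟩, fun x hx => ?_, ?_, hW'n.congr fun x hx => hG' hx,
    fun x hx a b c => ?_⟩
  · have := (hV'U hx.2).1.2
    rw [Set.mem_preimage, φ.left_inv hx.1] at this
    exact hWe this
  · refine ContMDiffOn.congr (fun x hx => ?_) fun x hx => hG hx
    obtain ⟨u, hu⟩ := hgu _ hx.2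
    refine ContMDiffAt.comp_contMDiffWithinAt (g := Ring.inverse) x ?_ (hW'n x hx)
    rw [← hu]
    exact (contDiffAt_ringInverse ℝ u).contMDiffAt
  · have hGs (f : F) : (G x).symm f = g (φ x) f := DFunLike.congr_fun (hG' hx) f
    have hμx : μ (φ x) = A.localProduct e x := congrArg (A.localProduct e) (φ.left_inv hx.1)
    have := hgμ _ hx.2 (G x a) (G x b) (G x c)
    simp only [← hGs, ContinuousLinearEquiv.symm_apply_apply, hμm, hμx] at this
    rw [← this, ContinuousLinearEquiv.apply_symm_apply]

/-- The model algebra is the fibre at `m` moved to `F`, so its para-associativity is inherited; the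
gauge identifies nearby fibres with it. -/
theorem ParaAssociativeAlgebroid.isParaAssociativeAlgebraBundle
    (A : ParaAssociativeAlgebroid n F V) {D : LinearConnection n F V} (hD : D.IsDifferential A) :
    IsParaAssociativeAlgebraBundle n F (fun m => A.fibre m) := by
  intro m
  let e := trivializationAt F V m
  have hm : m ∈ e.baseSet := FiberBundle.mem_baseSet_trivializationAt F V m
  obtain ⟨W, G, hW, hmW, hWe, hG, hG', hGμ⟩ := A.exists_smooth_gauge hD e hm
  obtain ⟨h1, h2⟩ := e.contMDiffOn_transFiberwiseLinear G hW hWe hG hG'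
  refine ⟨(A.fibre m).transport (e.linearEquivAt ℝ m hm),
    e.transFiberwiseLinear G hW hWe hG.continuousOn hG'.continuousOn, hmW, h1, h2, fun x hx =>
    ⟨(e.linearEquivAt ℝ x (hWe hx)).trans (G x).toLinearEquiv, fun α β γ => ?_, fun α => ?_⟩⟩
  · have hL (α : V x) : e.linearEquivAt ℝ x (hWe hx) α = e.linearMapAt ℝ x α := by
      rw [e.coe_linearMapAt_of_mem (hWe hx)]
      rfl
    have hμm (a b c : F) : ((A.fibre m).transport (e.linearEquivAt ℝ m hm)).prod a b c =
        A.localProduct e m a b c := by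
      change e.linearEquivAt ℝ m hm ((A.fibre m).prod (e.symm m a) (e.symm m b) (e.symm m c)) =
        e.linearMapAt ℝ m ((A.fibre m).prod (e.symmₗ ℝ m a) (e.symmₗ ℝ m b) (e.symmₗ ℝ m c))
      rw [e.symmₗ_apply hm, e.symmₗ_apply hm, e.symmₗ_apply hm, e.coe_linearMapAt_of_mem hm]
      rfl
    rw [hμm]
    change G x (e.linearEquivAt ℝ x (hWe hx) ((A.fibre x).prod α β γ)) = A.localProduct e m
      (G x (e.linearEquivAt ℝ x (hWe hx) α)) (G x (e.linearEquivAt ℝ x (hWe hx) β))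
      (G x (e.linearEquivAt ℝ x (hWe hx) γ))
    rw [← hGμ x hx, hL, hL, hL, hL, A.localProduct_apply_linearMapAt e (hWe hx)]
  · have h0 : (e ⟨x, α⟩).1 = x := e.coe_fst' (hWe hx)
    rw [e.transFiberwiseLinear_apply, h0]
    rfl

theorem IsParaAssociativeIso.symm {R A B : Type*} [CommRing R] [AddCommGroup A] [Module R A]
    [AddCommGroup B] [Module R B] {𝒜 : ParaAssociativeAlgebra R A}
    {ℬ : ParaAssociativeAlgebra R B} {φ : A ≃ₗ[R] B} (hφ : IsParaAssociativeIso 𝒜 ℬ φ) :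
    IsParaAssociativeIso ℬ 𝒜 φ.symm := fun x y z => by
  rw [LinearEquiv.symm_apply_eq, hφ]
  simp only [LinearEquiv.apply_symm_apply]

theorem IsParaAssociativeIso.trans {R A B C : Type*} [CommRing R] [AddCommGroup A] [Module R A]
    [AddCommGroup B] [Module R B] [AddCommGroup C] [Module R C] {𝒜 : ParaAssociativeAlgebra R A}
    {ℬ : ParaAssociativeAlgebra R B} {𝒞 : ParaAssociativeAlgebra R C} {φ : A ≃ₗ[R] B}
    {χ : B ≃ₗ[R] C} (hφ : IsParaAssociativeIso 𝒜 ℬ φ) (hχ : IsParaAssociativeIso ℬ 𝒞 χ) :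
    IsParaAssociativeIso 𝒜 𝒞 (φ.trans χ) := fun x y z => by
  simp only [LinearEquiv.trans_apply, hφ x y z, hχ _ _ _]

/-- Fibres over one bundle chart share a model, so being isomorphic is an equivalence relation with
open classes on a preconnected space. -/
theorem IsParaAssociativeAlgebraBundle.exists_fibre_iso {M : Type*} [TopologicalSpace M]
    [ChartedSpace (EuclideanSpace ℝ (Fin n)) M] [PreconnectedSpace M]
    {F : Type*} [NormedAddCommGroup F] [NormedSpace ℝ F]
    {V : M → Type*} [TopologicalSpace (TotalSpace F V)] [∀ m, AddCommGroup (V m)]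
    [∀ m, Module ℝ (V m)] [∀ m, TopologicalSpace (V m)] [FiberBundle F V]
    {μ : ∀ m, ParaAssociativeAlgebra ℝ (V m)} (h : IsParaAssociativeAlgebraBundle n F μ)
    (m m' : M) : ∃ φ : V m ≃ₗ[ℝ] V m', IsParaAssociativeIso (μ m) (μ m') φ := by
  refine PreconnectedSpace.induction₂'
    (fun x y => ∃ φ : V x ≃ₗ[ℝ] V y, IsParaAssociativeIso (μ x) (μ y) φ) (fun x => ?_)
    ⟨fun x y z ⟨φ, hφ⟩ ⟨χ, hχ⟩ => ⟨φ.trans χ, hφ.trans hχ⟩⟩ m m'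
  obtain ⟨𝒜, e, hx, -, -, he⟩ := h x
  obtain ⟨φ, hφ, -⟩ := he x hx
  filter_upwards [e.open_baseSet.mem_nhds hx] with y hy
  obtain ⟨χ, hχ, -⟩ := he y hy
  exact ⟨⟨φ.trans χ.symm, hφ.trans hχ.symm⟩, ⟨χ.trans φ.symm, hχ.trans hφ.symm⟩⟩

end Main

theorem mainTheorem1 (n : ℕ) {M : Type*} [TopologicalSpace M]
    [ChartedSpace (EuclideanSpace ℝ (Fin n)) M] [IsManifold (𝓡 n) ∞ M]
    [T2Space M] [SecondCountableTopology M] [ConnectedSpace M]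
    {F : Type*} [NormedAddCommGroup F] [NormedSpace ℝ F] [FiniteDimensional ℝ F]
    {V : M → Type*} [TopologicalSpace (TotalSpace F V)] [∀ m, AddCommGroup (V m)]
    [∀ m, Module ℝ (V m)] [∀ m, TopologicalSpace (V m)] [FiberBundle F V] [VectorBundle ℝ F V]
    [ContMDiffVectorBundle ∞ F V (𝓡 n)]
    (A : ParaAssociativeAlgebroid n F V)
    (hA : ∃ D : LinearConnection n F V, D.IsDifferential A) :
    IsParaAssociativeAlgebraBundle n F (fun m => A.fibre m) ∧
      ∀ m m' : M, ∃ φ : V m ≃ₗ[ℝ] V m', IsParaAssociativeIso (A.fibre m) (A.fibre m') φ := by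
  obtain ⟨D, hD⟩ := hA
  have h := ParaAssociativeAlgebroid.isParaAssociativeAlgebraBundle A hD
  exact ⟨h, h.exists_fibre_iso⟩
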